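/- Let $a,b,c\in\mathbb R$ satisfy either $c=0$ and $a\neq b$, or $c>0$ and $a<b$. Let $J_\nu$ be the Bessel function of the first kind, $N_\nu(z)=az^2J_\nu''(z)+bzJ_\nu'(z)+cJ_\nu(z)$, $Q(x)=ax(x-1)+bx+c$, and let $\nu_0$ be the largest real root of $Q$ ($\nu_0=-\infty$ if $Q$ has no real root). Put $$f_\nu(z)=\Big[\tfrac{2^\nu\Gamma(\nu+1)}{Q(\nu)}N_\nu(z)\Big]^{1/\nu}\ (\nu\neq0),\quad g_\nu(z)=\tfrac{2^\nu\Gamma(\nu+1)z^{1-\nu}}{Q(\nu)}N_\nu(z),\quad h_\nu(z)=\tfrac{2^\nu\Gamma(\nu+1)z^{1-\nu/2}}{Q(\nu)}N_\nu(\sqrt z),$$ where each formula stands for the analytic function around $0$ that takes the principal values of the formula at small positive $z$. For such a function $f$ and $\beta\in[0,1)$, the radius of starlikeness of order $\beta$ is the supremum of all $r>0$ such that $f$ is analytic in $|z|<r$ and $\operatorname{Re}\big(zf'(z)/f(z)\big)>\beta$ for all $|z|<r$ (with $zf'(z)/f(z)=1$ at $z=0$). Let $\beta\in[0,1)$ and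 let $\nu\ge\max\{0,\nu_0\}$ with $Q(\nu)\neq0$. Then each smallest positive root below exists, and: a) if $\nu\neq0$, the radius of starlikeness of order $\beta$ of $f_\nu$ is the smallest positive root of $$ar^3J_\nu'''(r)+(2a+b-a\nu\beta)r^2J_\nu''(r)+(b+c-b\nu\beta)rJ_\nu'(r)-c\nu\beta J_\nu(r)=0;$$ b) the radius of starlikeness of order $\beta$ of $g_\nu$ is the smallest positive root of $$(1-\nu)+\frac{ar^3J_\nu'''(r)+(2a+b)r^2J_\nu''(r)+(b+c)rJ_\nu'(r)}{ar^2J_\nu''(r)+brJ_\nu'(r)+cJ_\nu(r)}=\beta;$$ c) the radius of starlikeness of order $\beta$ of $h_\nu$ is the smallest positive root of $$(2-\nu)+\frac{ar\sqrt r\,J_\nu'''(\sqrt r)+(2a+b)rJ_\nu''(\sqrt r)+(b+c)\sqrt r\,J_\nu'(\sqrt r)}{arJ_\nu''(\sqrt r)+b\sqrt r\,J_\nu'(\sqrt r)+cJ_\nu(\sqrt r)}=2\beta.$$ -/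

import Mathlib

open Filter Topology

noncomputable section

/-- The Bessel function of the first kind of real order `ν` (principal branch of the powers),
`J_ν(z) = ∑ (-1)^n / (n! Γ(n+ν+1)) (z/2)^(2n+ν)`. -/
def besselJ (ν : ℝ) (z : ℂ) : ℂ :=
  ∑' n : ℕ, ((-1 : ℂ) ^ n / ((n.factorial : ℂ) * (Real.Gamma ((n : ℝ) + ν + 1) : ℂ))) *
    (z / 2) ^ (2 * (n : ℂ) + (ν : ℂ))

/-- The quadratic `Q(x) = a x (x - 1) + b x + c`. -/
def besselQ (a b c x : ℝ) : ℝ := a * x * (x - 1) + b * x + c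

/-- `N_ν(z) = a z² J_ν''(z) + b z J_ν'(z) + c J_ν(z)`. It is only ever evaluated off the branch cut
of `J_ν`, where `J_ν` is holomorphic. -/
def besselN (a b c ν : ℝ) (z : ℂ) : ℂ :=
  a * z ^ 2 * iteratedDeriv 2 (besselJ ν) z + b * z * iteratedDeriv 1 (besselJ ν) z
    + c * besselJ ν z

/-- `f_ν(z) = [2^ν Γ(ν+1) N_ν(z) / Q(ν)]^(1/ν)`. -/
def normF (a b c ν : ℝ) (z : ℂ) : ℂ :=
  (((2 : ℂ) ^ (ν : ℂ) * (Real.Gamma (ν + 1) : ℂ)) / (besselQ a b c ν : ℂ) * besselN a b c ν z)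
    ^ (1 / (ν : ℂ))

/-- `g_ν(z) = 2^ν Γ(ν+1) z^(1-ν) N_ν(z) / Q(ν)`. -/
def normG (a b c ν : ℝ) (z : ℂ) : ℂ :=
  ((2 : ℂ) ^ (ν : ℂ) * (Real.Gamma (ν + 1) : ℂ) * z ^ (1 - (ν : ℂ))) / (besselQ a b c ν : ℂ)
    * besselN a b c ν z

/-- `h_ν(z) = 2^ν Γ(ν+1) z^(1-ν/2) N_ν(√z) / Q(ν)`. -/
def normH (a b c ν : ℝ) (z : ℂ) : ℂ :=
  ((2 : ℂ) ^ (ν : ℂ) * (Real.Gamma (ν + 1) : ℂ) * z ^ (1 - (ν : ℂ) / 2)) / (besselQ a b c ν : ℂ)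
    * besselN a b c ν (z ^ (1 / 2 : ℂ))

/-- `F` is the single-valued analytic function on the disk `|z| < r` given by the formula `f`,
whose powers are multivalued: `F` is holomorphic on the disk and takes the principal values of the
formula at all small positive reals, which determines `F` on the disk. -/
def IsAnalyticBranchOn (f F : ℂ → ℂ) (r : ℝ) : Prop :=
  DifferentiableOn ℂ F (Metric.ball 0 r) ∧ ∀ᶠ x : ℝ in 𝓝[>] 0, F (x : ℂ) = f (x : ℂ)

/-- The radii `r > 0` such that (the analytic function given by) `f` is analytic in `|z| < r` and
`Re (z f'(z) / f(z)) > β` there. The quotient must make sense at every `z ≠ 0` of the disk; at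
`z = 0` it has the removable value `1`. -/
def starlikeRadii (β : ℝ) (f : ℂ → ℂ) : Set ℝ :=
  {r : ℝ | 0 < r ∧ ∃ F : ℂ → ℂ, IsAnalyticBranchOn f F r ∧
    ∀ z ∈ Metric.ball (0 : ℂ) r, z ≠ 0 → F z ≠ 0 ∧ β < (z * deriv F z / F z).re}

/-- `ρ` is the radius of starlikeness of order `β` of `f`: the least upper bound (in particular
finite and positive) of the radii of the disks on which `f` is starlike of order `β`. -/
def IsRadiusOfStarlikeness (β : ℝ) (f : ℂ → ℂ) (ρ : ℝ) : Prop :=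
  IsLUB (starlikeRadii β f) ρ

end

noncomputable section

/-! Write `N_ν(z) = (Q(ν)/Γ(ν+1)) (z/2)^ν φ(z²)` with `φ` entire and `φ(0) = 1`. Each normalized
function is then `z φ(z^p)^κ`, with `(κ, p)` equal to `(1/ν, 2)`, `(1, 2)` or `(1, 1)`, and its
starlikeness quotient is `1 + κ p w φ'(w)/φ(w)` at `w = z^p`. The point is that `φ` behaves like a
polynomial with only positive roots: up to the first zero, `Re (w φ'/φ)` is smallest on `|w| =
const` at `w = |w|`. Hence the radius is governed by the first positive zero of `(1-β) φ + κ p x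
φ'`, which is the displayed equation. No factorization of `φ` into its zeros is used. Its Jensen
polynomials have only positive roots (`posRooted_jensenPoly_besselQ`): for `J_ν` they are Laguerre
polynomials, and inserting the factor `Q(ν+2n)` amounts to differential operators that preserve
positive-rootedness (`PosRooted.second_order`). The inequalities are elementary for such polynomials
and survive the limit (`JensenPosRooted.div_le_re_div`, `div_le_mul`).
`JensenPosRooted.exists_first_zero` shows that the critical zero exists and precedes the zeros of
`φ`; `JensenPosRooted.isRadiusOfStarlikeness` identifies the radius. -/

/-! ### Polynomials with only positive roots and operators preserving them -/

/-- All complex roots of `P` are positive reals (in particular `P ≠ 0`). -/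
def PosRooted (P : Polynomial ℂ) : Prop := ∀ z, P.eval z = 0 → 0 < z.re ∧ z.im = 0

open Polynomial in
theorem PosRooted.ne_zero {P : ℂ[X]} (h : PosRooted P) : P ≠ 0 := by
  rintro rfl
  simpa using (h 0 (by simp)).1

open Polynomial in
theorem PosRooted.of_mem_roots {P : ℂ[X]} (h : PosRooted P) {r : ℂ} (hr : r ∈ P.roots) :
    0 < r.re ∧ r.im = 0 := h r ((mem_roots h.ne_zero).1 hr)

open Polynomial in
theorem mul_eval_derivative_eq {P : ℂ[X]} {x : ℂ} (hx : P.eval x ≠ 0) :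
    x * P.derivative.eval x = P.eval x * (P.roots.map fun r ↦ x / (x - r)).sum := by
  rw [(IsAlgClosed.splits P).eval_derivative_eq_eval_mul_sum hx, mul_left_comm,
    ← Multiset.sum_map_mul_left]
  simp only [mul_one_div]

/-- For real `r > 0` the Möbius map `x ↦ x/(x-r)` has determinant `-r < 0`, so it swaps the upper
and lower half-planes. -/
theorem im_mul_im_div_sub {x r : ℂ} (hr : 0 < r.re ∧ r.im = 0) (hx : x.im ≠ 0) :
    x.im * (x / (x - r)).im < 0 := by
  have hn : 0 < Complex.normSq (x - r) := by
    rw [Complex.normSq_pos]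
    intro h
    apply hx
    have := congrArg Complex.im h
    simpa [hr.2] using this
  have h1 : x.im * (x / (x - r)).im = -(r.re * x.im ^ 2 / Complex.normSq (x - r)) := by
    rw [Complex.div_im]
    simp only [Complex.sub_re, Complex.sub_im, hr.2]
    field_simp
    ring
  rw [h1]
  have := hr.1
  have : 0 < x.im ^ 2 := by positivity
  have : 0 < r.re * x.im ^ 2 / Complex.normSq (x - r) := by positivity
  linarith

theorem re_div_sub_nonneg {x r : ℂ} (hr : 0 < r.re ∧ r.im = 0) (hx : x.im = 0) (hx' : x.re ≤ 0) :
    0 ≤ (x / (x - r)).re := by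
  rw [Complex.div_re]
  simp only [Complex.sub_re, Complex.sub_im, hr.2, hx]
  have h : 0 ≤ x.re * (x.re - r.re) := mul_nonneg_of_nonpos_of_nonpos hx' (by linarith [hr.1])
  have := Complex.normSq_nonneg (x - r)
  simp only [sub_self, mul_zero, zero_div, add_zero]
  positivity

theorem sub_ne_zero_of_not_pos {x r : ℂ} (hr : 0 < r.re ∧ r.im = 0)
    (hx : ¬ (0 < x.re ∧ x.im = 0)) : x - r ≠ 0 := by
  intro h
  rw [sub_eq_zero] at h
  exact hx (h ▸ hr)

theorem sum_im_mul_im_neg {x : ℂ} (hx : x.im ≠ 0) {s : Multiset ℂ}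
    (hs : ∀ r ∈ s, 0 < r.re ∧ r.im = 0) (h0 : s ≠ 0) :
    x.im * (s.map fun r ↦ x / (x - r)).sum.im < 0 := by
  induction s using Multiset.induction with
  | empty => exact absurd rfl h0
  | cons r s ih =>
    have h1 := im_mul_im_div_sub (hs r (by simp)) hx
    rw [Multiset.map_cons, Multiset.sum_cons, Complex.add_im, mul_add]
    by_cases hs0 : s = 0
    · subst hs0; simpa using h1
    · linarith [ih (fun r hr => hs r (by simp [hr])) hs0]

theorem sum_re_nonneg {x : ℂ} (hx : x.im = 0) (hx' : x.re ≤ 0) {s : Multiset ℂ}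
    (hs : ∀ r ∈ s, 0 < r.re ∧ r.im = 0) :
    0 ≤ (s.map fun r ↦ x / (x - r)).sum.re := by
  induction s using Multiset.induction with
  | empty => simp
  | cons r s ih =>
    have h1 := re_div_sub_nonneg (hs r (by simp)) hx hx'
    rw [Multiset.map_cons, Multiset.sum_cons, Complex.add_re]
    linarith [ih (fun r hr => hs r (by simp [hr]))]

/-- `x (S - m)` with `S = ∑ x / (x - r)` over `m` positive reals `r` has the sign of `S`. -/
theorem mul_sum_sub_card_sign {x : ℂ} (hx : ¬ (0 < x.re ∧ x.im = 0)) {s : Multiset ℂ}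
    (hs : ∀ r ∈ s, 0 < r.re ∧ r.im = 0) :
    x.im * (x * ((s.map fun r ↦ x / (x - r)).sum - s.card)).im ≤ 0 ∧
      (x.im = 0 → 0 ≤ (x * ((s.map fun r ↦ x / (x - r)).sum - s.card)).re) := by
  induction s using Multiset.induction with
  | empty => simp
  | cons r s ih =>
    have hr := hs r (by simp)
    obtain ⟨i1, i2⟩ := ih (fun r hr => hs r (by simp [hr]))
    have hne := sub_ne_zero_of_not_pos hr hx
    have hrr : r = (r.re : ℂ) := Complex.ext (by simp) (by simp [hr.2])
    -- Since `x (x/(x-r) - 1) = r · x/(x-r)`, each root contributes a positive multiple of its term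
    -- in `S`.
    have key : x * (((r ::ₘ s).map fun r ↦ x / (x - r)).sum - (r ::ₘ s).card)
        = (r.re : ℂ) * (x / (x - r)) + x * ((s.map fun r ↦ x / (x - r)).sum - s.card) := by
      rw [Multiset.map_cons, Multiset.sum_cons, Multiset.card_cons, ← hrr]
      push_cast
      field_simp
      ring
    rw [key, Complex.add_im, Complex.add_re, Complex.re_ofReal_mul, Complex.im_ofReal_mul]
    constructor
    · by_cases h : x.im = 0
      · simp [h]
      · nlinarith [mul_pos hr.1 (neg_pos.2 (im_mul_im_div_sub hr h))]
    · intro h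
      have := re_div_sub_nonneg hr h (by by_contra! h'; exact hx ⟨h', h⟩)
      have := mul_nonneg hr.1.le this
      linarith [i2 h]

open Polynomial in
-- Away from the roots of `P`, dividing by `P` leaves `S + s - x` with `S = ∑ x/(x-r)`. Off the real
-- axis `S` and `-x` do not pull the imaginary part in opposite directions; for `x ≤ 0` all terms
-- are nonnegative and `s > 0`.
theorem PosRooted.mul_derivative_add_sub_mul {P : ℂ[X]} (h : PosRooted P) {s : ℝ} (hs : 0 < s) :
    PosRooted (X * derivative P + (C (s : ℂ) - X) * P) := by
  intro x hx0
  by_contra hx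
  have hP : P.eval x ≠ 0 := fun h' => hx (h x h')
  simp only [eval_add, eval_mul, eval_X, eval_sub, eval_C] at hx0
  rw [mul_eval_derivative_eq hP, mul_comm (_ - _), ← mul_add] at hx0
  have h0 := (mul_eq_zero.1 hx0).resolve_left hP
  by_cases him : x.im = 0
  · have hre : x.re ≤ 0 := by by_contra! h'; exact hx ⟨h', him⟩
    have h1 := sum_re_nonneg him hre fun r hr => h.of_mem_roots hr
    have h2 := congrArg Complex.re h0
    simp only [Complex.add_re, Complex.sub_re, Complex.ofReal_re, Complex.zero_re] at h2
    linarith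
  · have h1 : x.im * (P.roots.map fun r ↦ x / (x - r)).sum.im ≤ 0 := by
      by_cases h0 : P.roots = 0
      · simp [h0]
      · exact (sum_im_mul_im_neg him (fun r hr => h.of_mem_roots hr) h0).le
    have h2 := congrArg Complex.im h0
    simp only [Complex.add_im, Complex.sub_im, Complex.ofReal_im, Complex.zero_im] at h2
    have : 0 < x.im ^ 2 := by positivity
    have h3 : x.im * ((P.roots.map fun r ↦ x / (x - r)).sum.im + (0 - x.im)) = 0 := by
      rw [h2, mul_zero]
    nlinarith

open Polynomial in
-- Dividing by `P` gives `δ S + q + e x (S - m)` with `m = deg P`, and `x (S - m)` has the same sign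
-- behaviour as `S`. The term `-e m X` is what produces the subtraction of `m`.
theorem PosRooted.second_order {P : ℂ[X]} (h : PosRooted P) {δ e q : ℝ} (hδ : 0 < δ) (he : 0 ≤ e)
    (hq : 0 < q) :
    PosRooted ((C (δ : ℂ) * X + C (e : ℂ) * X ^ 2) * derivative P
      + (C (q : ℂ) - C ((e * P.natDegree : ℝ) : ℂ) * X) * P) := by
  intro x hx0
  by_contra hx
  have hP : P.eval x ≠ 0 := fun h' => hx (h x h')
  have hcard : P.natDegree = P.roots.card := (IsAlgClosed.splits P).natDegree_eq_card_roots
  set S := (P.roots.map fun r ↦ x / (x - r)).sum with hS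
  have h0 : (δ : ℂ) * S + q + e * (x * (S - P.roots.card)) = 0 := by
    have h1 := mul_eval_derivative_eq hP
    simp only [eval_add, eval_mul, eval_X, eval_sub, eval_C, eval_pow, hcard] at hx0
    rw [← hS] at h1
    refine (mul_eq_zero.1 ?_).resolve_left hP
    rw [← hx0]
    push_cast
    linear_combination (-(δ : ℂ) - e * x) * h1
  have hr := fun r (hr : r ∈ P.roots) => h.of_mem_roots hr
  obtain ⟨i1, i2⟩ := mul_sum_sub_card_sign hx hr
  rw [← hS] at i1 i2
  -- The strict inequality for `Im S` needs at least one root; for constant `P` only `q` remains.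
  by_cases hroots : P.roots = 0
  · have : S = 0 := by simp [hS, hroots]
    rw [this, hroots] at h0
    simp at h0
    exact hq.ne' h0
  by_cases him : x.im = 0
  · have hre : x.re ≤ 0 := by by_contra! h'; exact hx ⟨h', him⟩
    have h1 := sum_re_nonneg him hre hr
    have h2 := congrArg Complex.re h0
    simp only [Complex.add_re, Complex.re_ofReal_mul, Complex.ofReal_re, Complex.zero_re] at h2
    nlinarith [mul_nonneg hδ.le h1, mul_nonneg he (i2 him)]
  · have h1 := sum_im_mul_im_neg him hr hroots
    have h2 := congrArg Complex.im h0
    simp only [Complex.add_im, Complex.im_ofReal_mul, Complex.ofReal_im, Complex.zero_im] at h2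
    rw [← hS] at h1
    have h3 : δ * (x.im * S.im) + e * (x.im * (x * (S - P.roots.card)).im) = 0 := by
      linear_combination x.im * h2
    nlinarith [mul_pos hδ (neg_pos.2 h1), mul_nonneg he (neg_nonneg.2 i1)]

open Polynomial in
theorem PosRooted.neg {P : ℂ[X]} (h : PosRooted P) : PosRooted (-P) :=
  fun z hz => h z (by simpa using hz)

open Polynomial in
theorem PosRooted.C_mul {P : ℂ[X]} (h : PosRooted P) {k : ℂ} (hk : k ≠ 0) : PosRooted (C k * P) :=
  fun z hz => h z (by simpa [hk] using hz)

open Polynomial in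
theorem PosRooted.comp_C_mul_X {P : ℂ[X]} (h : PosRooted P) {t : ℝ} (ht : 0 < t) :
    PosRooted (P.comp (C (t : ℂ) * X)) := by
  intro z hz
  have := h (t * z) (by simpa using hz)
  rw [Complex.re_ofReal_mul, Complex.im_ofReal_mul] at this
  exact ⟨pos_of_mul_pos_right this.1 ht.le, by simpa [ht.ne'] using this.2⟩

/-! ### Bounds on a disk free of roots -/

section Bounds

open Polynomial

variable {P : ℂ[X]} {R : ℝ}

theorem PosRooted.lt_re_of_mem_roots (h : PosRooted P) (hR : ∀ x : ℝ, 0 < x → x ≤ R → P.eval ↑x ≠ 0)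
    {r : ℂ} (hr : r ∈ P.roots) : R < r.re ∧ r = (r.re : ℂ) := by
  have h1 := h.of_mem_roots hr
  have hrr : r = (r.re : ℂ) := Complex.ext (by simp) (by simp [h1.2])
  refine ⟨?_, hrr⟩
  by_contra! h'
  exact hR r.re h1.1 h' (hrr ▸ ((mem_roots h.ne_zero).1 hr))

theorem PosRooted.eval_ne_zero (h : PosRooted P) (hR : ∀ x : ℝ, 0 < x → x ≤ R → P.eval ↑x ≠ 0)
    {w : ℂ} (hw : ‖w‖ ≤ R) : P.eval w ≠ 0 := by
  intro h0
  have h1 := h w h0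
  have hww : w = (w.re : ℂ) := Complex.ext (by simp) (by simp [h1.2])
  exact hR w.re h1.1 ((Complex.re_le_norm w).trans hw) (hww ▸ h0)

/-- Factor by factor, `r - |w| ≤ |w - r|`, because every root `r` exceeds `R ≥ |w|`. -/
theorem PosRooted.norm_eval_le (h : PosRooted P) (hR : ∀ x : ℝ, 0 < x → x ≤ R → P.eval ↑x ≠ 0)
    {w : ℂ} (hw : ‖w‖ ≤ R) : ‖P.eval (‖w‖ : ℂ)‖ ≤ ‖P.eval w‖ := by
  rw [(IsAlgClosed.splits P).eval_eq_prod_roots, (IsAlgClosed.splits P).eval_eq_prod_roots,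
    norm_mul, norm_mul]
  refine mul_le_mul_of_nonneg_left ?_ (norm_nonneg _)
  change (normHom : ℂ →*₀ ℝ) _ ≤ (normHom : ℂ →*₀ ℝ) _
  rw [map_multiset_prod, map_multiset_prod, Multiset.map_map, Multiset.map_map]
  refine Multiset.prod_map_le_prod_map₀ _ _ (fun r _ => norm_nonneg ((‖w‖ : ℂ) - r)) fun r hr => ?_
  obtain ⟨h1, h2⟩ := h.lt_re_of_mem_roots hR hr
  change ‖(‖w‖ : ℂ) - r‖ ≤ ‖w - r‖
  rw [h2, ← Complex.ofReal_sub, Complex.norm_real, Real.norm_eq_abs, abs_sub_comm,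
    abs_of_nonneg (by linarith), norm_sub_rev]
  have := norm_sub_norm_le (r.re : ℂ) w
  rw [Complex.norm_real, Real.norm_eq_abs, abs_of_nonneg (by linarith [norm_nonneg w])] at this
  exact this

theorem Multiset.sum_map_re_le {s : Multiset ℂ} {f g : ℂ → ℂ}
    (h : ∀ r ∈ s, (f r).re ≤ (g r).re) : (s.map f).sum.re ≤ (s.map g).sum.re := by
  induction s using Multiset.induction with
  | empty => simp
  | cons r s ih =>
    simp only [Multiset.map_cons, Multiset.sum_cons, Complex.add_re]
    linarith [h r (by simp), ih fun r hr => h r (by simp [hr])]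

/-- Each term satisfies `Re (w/(w-r)) ≥ -|w|/(r-|w|)`, with equality at `w = |w|`. -/
theorem PosRooted.re_mul_logDeriv_le (h : PosRooted P)
    (hR : ∀ x : ℝ, 0 < x → x ≤ R → P.eval ↑x ≠ 0) {w : ℂ} (hw : ‖w‖ ≤ R) :
    ((‖w‖ : ℂ) * P.derivative.eval (‖w‖ : ℂ) / P.eval (‖w‖ : ℂ)).re
      ≤ (w * P.derivative.eval w / P.eval w).re := by
  have e1 := h.eval_ne_zero hR hw
  have e2 : P.eval (‖w‖ : ℂ) ≠ 0 := h.eval_ne_zero hR (by simpa using hw)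
  rw [mul_eval_derivative_eq e1, mul_eval_derivative_eq e2, mul_div_cancel_left₀ _ e1,
    mul_div_cancel_left₀ _ e2]
  refine Multiset.sum_map_re_le fun r hr => ?_
  obtain ⟨h1, h2⟩ := h.lt_re_of_mem_roots hR hr
  rw [h2, ← Complex.ofReal_sub, ← Complex.ofReal_div, Complex.ofReal_re]
  have hpos : 0 < r.re - ‖w‖ := by linarith
  have h3 : ‖w / (w - r.re)‖ ≤ ‖w‖ / (r.re - ‖w‖) := by
    rw [norm_div, norm_sub_rev]
    have := norm_sub_norm_le (r.re : ℂ) w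
    rw [Complex.norm_real, Real.norm_eq_abs, abs_of_nonneg (by linarith [norm_nonneg w])] at this
    gcongr
  have h4 := neg_le_of_abs_le ((Complex.abs_re_le_norm _).trans h3)
  rw [← neg_sub r.re, div_neg]
  exact h4

/-- Termwise `x/(x-r) ≤ -x/r`. This linear bound later forces a critical zero to exist. -/
theorem PosRooted.re_mul_logDeriv_le_mul (h : PosRooted P)
    (hR : ∀ x : ℝ, 0 < x → x ≤ R → P.eval ↑x ≠ 0) {x : ℝ} (hx0 : 0 ≤ x) (hx : x ≤ R) :
    ((x : ℂ) * P.derivative.eval (x : ℂ) / P.eval (x : ℂ)).re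
      ≤ x * (P.derivative.eval 0 / P.eval 0).re := by
  have e1 : P.eval (x : ℂ) ≠ 0 := h.eval_ne_zero hR (by simpa [abs_of_nonneg hx0] using hx)
  have e2 : P.eval 0 ≠ 0 := h.eval_ne_zero hR (by simpa using hx0.trans hx)
  rw [mul_eval_derivative_eq e1, mul_div_cancel_left₀ _ e1,
    (IsAlgClosed.splits P).eval_derivative_div_eval_of_ne_zero e2, ← Complex.re_ofReal_mul,
    ← Multiset.sum_map_mul_left]
  refine Multiset.sum_map_re_le fun r hr => ?_
  obtain ⟨h1, h2⟩ := h.lt_re_of_mem_roots hR hr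
  rw [h2, ← Complex.ofReal_sub, ← Complex.ofReal_div, Complex.ofReal_re, Complex.re_ofReal_mul,
    zero_sub, ← Complex.ofReal_neg, ← Complex.ofReal_one, ← Complex.ofReal_div, Complex.ofReal_re,
    ← neg_sub r.re x, div_neg, div_neg, mul_neg, mul_one_div, neg_le_neg_iff]
  have : 0 < r.re - x := by linarith
  gcongr
  linarith

end Bounds

/-! ### Jensen polynomials and the Laguerre family -/

section Jensen

open Polynomial

/-- The polynomial `∑ (m choose n) d n X^n`. -/
def jensenPoly (m : ℕ) (d : ℕ → ℝ) : ℂ[X] :=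
  ∑ n ∈ Finset.range (m + 1), C ((m.choose n * d n : ℝ) : ℂ) * X ^ n

theorem coeff_jensenPoly (m : ℕ) (d : ℕ → ℝ) (n : ℕ) :
    (jensenPoly m d).coeff n = ((m.choose n * d n : ℝ) : ℂ) := by
  simp only [jensenPoly, finsetSum_coeff, coeff_C_mul, coeff_X_pow, mul_ite, mul_one, mul_zero]
  rw [Finset.sum_ite_eq]
  split_ifs with h
  · rfl
  · rw [Nat.choose_eq_zero_of_lt (by simpa using h)]; simp

/-- Coefficients of the Laguerre polynomials of parameter `α`. -/
def laguerreCoeff (α : ℝ) (n : ℕ) : ℝ := (-1) ^ n / Real.Gamma (n + α + 1)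

theorem laguerreCoeff_eq_mul_succ {α : ℝ} (hα : -1 < α) (n : ℕ) :
    laguerreCoeff α n = -(n + α + 1) * laguerreCoeff α (n + 1) := by
  have h : (n : ℝ) + α + 1 ≠ 0 := by have : (0 : ℝ) ≤ n := n.cast_nonneg; linarith
  have h' : Real.Gamma (n + α + 1) ≠ 0 :=
    (Real.Gamma_pos_of_pos (by have : (0 : ℝ) ≤ n := n.cast_nonneg; linarith)).ne'
  have e : Real.Gamma ((n + 1 : ℕ) + α + 1) = (n + α + 1) * Real.Gamma (n + α + 1) := by
    rw [← Real.Gamma_add_one h]; congr 1; push_cast; ring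
  rw [laguerreCoeff, laguerreCoeff, e, pow_succ]
  field_simp

theorem laguerreCoeff_eq_mul_add_one {α : ℝ} (hα : -1 < α) (n : ℕ) :
    laguerreCoeff α n = (n + α + 1) * laguerreCoeff (α + 1) n := by
  have h : (n : ℝ) + α + 1 ≠ 0 := by have : (0 : ℝ) ≤ n := n.cast_nonneg; linarith
  have h' : Real.Gamma (n + α + 1) ≠ 0 :=
    (Real.Gamma_pos_of_pos (by have : (0 : ℝ) ≤ n := n.cast_nonneg; linarith)).ne'
  have e : Real.Gamma (n + (α + 1) + 1) = (n + α + 1) * Real.Gamma (n + α + 1) := by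
    rw [← Real.Gamma_add_one h]; congr 1; ring
  rw [laguerreCoeff, laguerreCoeff, e]
  field_simp

theorem laguerreCoeff_ne_zero {α : ℝ} (hα : -1 < α) (n : ℕ) : laguerreCoeff α n ≠ 0 :=
  div_ne_zero (by simp)
    (Real.Gamma_pos_of_pos (by have : (0 : ℝ) ≤ n := n.cast_nonneg; linarith)).ne'

/-- A Rodrigues-type recurrence for Laguerre polynomials: the degree goes up while the parameter
comes down, by the operator of `PosRooted.mul_derivative_add_sub_mul`. -/
theorem jensenPoly_laguerreCoeff_succ {α : ℝ} (hα : -1 < α) (m : ℕ) :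
    jensenPoly (m + 1) (laguerreCoeff α) =
      X * derivative (jensenPoly m (laguerreCoeff (α + 1)))
        + (C ((α + 1 : ℝ) : ℂ) - X) * jensenPoly m (laguerreCoeff (α + 1)) := by
  ext n
  rw [coeff_jensenPoly, sub_mul, coeff_add, coeff_sub, coeff_C_mul, coeff_jensenPoly]
  cases n with
  | zero =>
    rw [laguerreCoeff_eq_mul_add_one hα]
    simp
  | succ n =>
    rw [coeff_X_mul, coeff_X_mul, coeff_derivative, coeff_jensenPoly, coeff_jensenPoly]
    have h1 : laguerreCoeff (α + 1) n = -laguerreCoeff α (n + 1) := by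
      have := laguerreCoeff_eq_mul_add_one hα n
      have h2 := laguerreCoeff_eq_mul_succ hα n
      have h : (n : ℝ) + α + 1 ≠ 0 := by have : (0 : ℝ) ≤ n := n.cast_nonneg; linarith
      refine mul_left_cancel₀ h ?_
      linarith
    rw [h1, laguerreCoeff_eq_mul_add_one hα, Nat.choose_succ_succ]
    push_cast
    ring

theorem posRooted_jensenPoly_laguerreCoeff (m : ℕ) {α : ℝ} (hα : -1 < α) :
    PosRooted (jensenPoly m (laguerreCoeff α)) := by
  induction m generalizing α with
  | zero =>
    intro z hz
    have h := laguerreCoeff_ne_zero hα 0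
    simp [jensenPoly, h] at hz
  | succ m ih =>
    rw [jensenPoly_laguerreCoeff_succ hα]
    exact (ih (by linarith)).mul_derivative_add_sub_mul (by linarith)

theorem natDegree_jensenPoly {m : ℕ} {d : ℕ → ℝ} (hd : d m ≠ 0) :
    (jensenPoly m d).natDegree = m := by
  refine natDegree_eq_of_le_of_coeff_ne_zero ?_ (by simpa [coeff_jensenPoly] using hd)
  rw [natDegree_le_iff_coeff_eq_zero]
  intro n hn
  rw [coeff_jensenPoly, Nat.choose_eq_zero_of_lt hn]
  simp

/-- The factor `2n + s` is the action of `2X d/dX + s` on coefficients, the case `e = 0` of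
`PosRooted.second_order`. -/
theorem PosRooted.jensenPoly_linear_mul {m : ℕ} {d : ℕ → ℝ} (h : PosRooted (jensenPoly m d))
    {s : ℝ} (hs : 0 < s) : PosRooted (jensenPoly m fun n => (2 * n + s) * d n) := by
  convert h.second_order two_pos le_rfl hs using 1
  ext n
  simp only [zero_mul, Complex.ofReal_zero, C_0, add_zero, sub_zero]
  rw [coeff_add, mul_assoc, coeff_C_mul, coeff_C_mul, coeff_jensenPoly, coeff_jensenPoly]
  cases n with
  | zero => simp
  | succ n =>
    rw [coeff_X_mul, coeff_derivative, coeff_jensenPoly]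
    push_cast
    ring

/-- Here `Q` may have no real root, so it is not factored. Instead `Q(ν+2n) = 4a n(n+ν) + 2(b-a) n +
Q(ν)`, and the Gamma recurrence turns `(n+ν) dₙ` into `-dₙ₋₁`. The quadratic part thus becomes the
first-order operator `4a (X² d/dX - m X)`. -/
theorem posRooted_jensenPoly_besselQ_of_nonneg {a b c ν : ℝ} (ha : 0 ≤ a) (hab : a < b) (hc : 0 ≤ c)
    (hν : 0 ≤ ν) (hQ : besselQ a b c ν ≠ 0) (m : ℕ) :
    PosRooted (jensenPoly m fun n => besselQ a b c (ν + 2 * n) * laguerreCoeff ν n) := by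
  have hν' : -1 < ν := by linarith
  have hpos : 0 < besselQ a b c ν := by
    refine lt_of_le_of_ne ?_ hQ.symm
    have : besselQ a b c ν = a * ν ^ 2 + (b - a) * ν + c := by rw [besselQ]; ring
    rw [this]
    have : 0 ≤ b - a := by linarith
    positivity
  convert (posRooted_jensenPoly_laguerreCoeff m hν').second_order (δ := 2 * (b - a)) (e := 4 * a)
    (by linarith) (by linarith) hpos using 1
  rw [natDegree_jensenPoly (laguerreCoeff_ne_zero hν' m)]
  ext n
  rw [coeff_add, add_mul, sub_mul, coeff_add, coeff_sub, mul_assoc, mul_assoc, mul_assoc,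
    coeff_C_mul, coeff_C_mul, coeff_C_mul, coeff_C_mul, coeff_jensenPoly, coeff_jensenPoly]
  cases n with
  | zero => simp
  | succ n =>
    rw [coeff_X_mul, pow_two, mul_assoc, coeff_X_mul, coeff_X_mul, coeff_derivative,
      coeff_jensenPoly, coeff_jensenPoly]
    have h1 := laguerreCoeff_eq_mul_succ hν' n
    have hX : (X * derivative (jensenPoly m (laguerreCoeff ν))).coeff n =
        ((n * (m.choose n * laguerreCoeff ν n) : ℝ) : ℂ) := by
      cases n with
      | zero => simp
      | succ n =>
        rw [coeff_X_mul, coeff_derivative, coeff_jensenPoly]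
        push_cast
        ring
    have h2 : ((m : ℝ) - n) * m.choose n = (n + 1) * m.choose (n + 1) := by
      have := Nat.choose_succ_right_eq m n
      by_cases hn : n ≤ m
      · have h3 : ((m.choose (n + 1) * (n + 1) : ℕ) : ℝ) = (m.choose n * (m - n) : ℕ) := by
          rw [this]
        push_cast [Nat.cast_sub hn] at h3
        linarith
      · rw [Nat.choose_eq_zero_of_lt (by omega), Nat.choose_eq_zero_of_lt (by omega)]
        simp
    rw [hX]
    norm_cast
    have h3 : besselQ a b c (ν + 2 * (n + 1 : ℕ)) =
        4 * a * (n + 1) * (n + 1 + ν) + 2 * (b - a) * (n + 1) + besselQ a b c ν := by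
      rw [besselQ, besselQ]; push_cast; ring
    rw [show ((2 * (n + 1) : ℕ) : ℝ) = 2 * ((n + 1 : ℕ) : ℝ) by push_cast; ring, h3, h1]
    push_cast
    linear_combination (4 * a * (n + ν + 1) * laguerreCoeff ν (n + 1)) * (-h2)

/-- With `a < 0 ≤ c` the discriminant is nonnegative, so `Q` splits over the reals. Both roots lie
below `ν`, and `ν + 2n - ρ` has the form `2n + s` with `s > 0`. -/
theorem posRooted_jensenPoly_besselQ_of_neg {a b c ν : ℝ} (ha : a < 0) (hc : 0 ≤ c)
    (hν : 0 ≤ ν) (hQ : ∀ x, ν ≤ x → besselQ a b c x ≠ 0) (m : ℕ) :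
    PosRooted (jensenPoly m fun n => besselQ a b c (ν + 2 * n) * laguerreCoeff ν n) := by
  set s := √((b - a) ^ 2 - 4 * a * c) with hs
  have hs2 : s * s = (b - a) ^ 2 - 4 * a * c :=
    Real.mul_self_sqrt (by nlinarith [sq_nonneg (b - a), mul_nonneg (neg_nonneg.2 ha.le) hc])
  have hfac : ∀ x, besselQ a b c x =
      a * ((x - (-(b - a) + s) / (2 * a)) * (x - (-(b - a) - s) / (2 * a))) := by
    intro x
    have := ha.ne
    rw [besselQ]
    field_simp
    linear_combination hs2
  have hroot : ∀ ρ, besselQ a b c ρ = 0 → 0 < ν - ρ := by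
    intro ρ hρ
    by_contra! h
    exact hQ ρ (by linarith) hρ
  have h1 := hroot ((-(b - a) + s) / (2 * a)) (by rw [hfac]; simp)
  have h2 := hroot ((-(b - a) - s) / (2 * a)) (by rw [hfac]; simp)
  have h3 := (((posRooted_jensenPoly_laguerreCoeff m (by linarith : -1 < ν)).jensenPoly_linear_mul
    h1).jensenPoly_linear_mul h2).C_mul (k := (a : ℂ)) (by exact_mod_cast ha.ne)
  convert h3 using 1
  ext n
  rw [coeff_C_mul, coeff_jensenPoly, coeff_jensenPoly, hfac]
  push_cast
  ring

/-- The hypotheses on `a`, `b`, `c` up to the sign of `Q` make the Jensen polynomials of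
`Q(ν + 2 n) / Γ(n + ν + 1)` real-rooted. -/
theorem posRooted_jensenPoly_besselQ {a b c ν : ℝ} (habc : (c = 0 ∧ a ≠ b) ∨ (0 < c ∧ a < b))
    (hν : 0 ≤ ν) (hQ : ∀ x, ν ≤ x → besselQ a b c x ≠ 0) (m : ℕ) :
    PosRooted (jensenPoly m fun n => besselQ a b c (ν + 2 * n) * laguerreCoeff ν n) := by
  have key : ∀ a b c : ℝ, a < b → 0 ≤ c → (∀ x, ν ≤ x → besselQ a b c x ≠ 0) →
      PosRooted (jensenPoly m fun n => besselQ a b c (ν + 2 * n) * laguerreCoeff ν n) := by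
    intro a b c hab hc hQ
    rcases lt_or_ge a 0 with ha | ha
    · exact posRooted_jensenPoly_besselQ_of_neg ha hc hν hQ m
    · exact posRooted_jensenPoly_besselQ_of_nonneg ha hab hc hν (hQ ν le_rfl) m
  rcases habc with ⟨rfl, hab⟩ | ⟨hc, hab⟩
  · rcases lt_or_gt_of_ne hab with hab | hab
    · exact key a b 0 hab le_rfl hQ
    -- When `c = 0`, changing the signs of `a` and `b` only negates `Q`, which reduces `a > b` to `a
    -- < b`.
    · have hneg : ∀ x, besselQ (-a) (-b) 0 x = -besselQ a b 0 x := by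
        intro x; rw [besselQ, besselQ]; ring
      have := (key (-a) (-b) 0 (by linarith) le_rfl
        (fun x hx => by rw [hneg]; exact neg_ne_zero.2 (hQ x hx))).neg
      convert this using 1
      ext n
      rw [coeff_neg, coeff_jensenPoly, coeff_jensenPoly, hneg]
      push_cast
      ring
  · exact key a b c hab hc.le hQ

end Jensen

/-! ### Entire functions given by real coefficients -/

/-- The coefficients `c` define an entire power series. -/
def EntireCoeff (c : ℕ → ℝ) : Prop := ∀ R : ℝ, 0 ≤ R → Summable fun n => |c n| * R ^ n

/-- The power series `∑ c n z ^ n`. -/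
def entireSum (c : ℕ → ℝ) (z : ℂ) : ℂ := ∑' n, (c n : ℂ) * z ^ n

/-- The power series `∑ c n x ^ n` on the real line. -/
def realSum (c : ℕ → ℝ) (x : ℝ) : ℝ := ∑' n, c n * x ^ n

variable {c d : ℕ → ℝ}

theorem EntireCoeff.mono (hc : EntireCoeff c) (h : ∀ n, |d n| ≤ |c n|) : EntireCoeff d :=
  fun R hR => Summable.of_nonneg_of_le (fun _ => by positivity)
    (fun n => mul_le_mul_of_nonneg_right (h n) (by positivity)) (hc R hR)

theorem EntireCoeff.add (hc : EntireCoeff c) (hd : EntireCoeff d) :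
    EntireCoeff fun n => c n + d n := fun R hR => by
  refine Summable.of_nonneg_of_le (fun _ => by positivity) (fun n => ?_) ((hc R hR).add (hd R hR))
  rw [← add_mul]
  exact mul_le_mul_of_nonneg_right (abs_add_le _ _) (by positivity)

theorem EntireCoeff.const_mul (hc : EntireCoeff c) (k : ℝ) : EntireCoeff fun n => k * c n :=
  fun R hR => by
  simpa only [abs_mul, mul_assoc] using (hc R hR).mul_left |k|

theorem EntireCoeff.nat_mul (hc : EntireCoeff c) : EntireCoeff fun n => n * c n := fun R hR => by
  -- The factor `n ≤ 2^n` is absorbed by doubling the radius.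
  refine Summable.of_nonneg_of_le (fun _ => by positivity) (fun n => ?_)
    (hc (2 * R) (by positivity))
  rw [abs_mul, Nat.abs_cast, mul_pow, mul_comm (n : ℝ), mul_assoc]
  have : (n : ℝ) ≤ 2 ^ n := by exact_mod_cast Nat.lt_two_pow_self.le
  gcongr

theorem EntireCoeff.summable (hc : EntireCoeff c) (z : ℂ) : Summable fun n => (c n : ℂ) * z ^ n :=
  Summable.of_norm (by simpa using hc ‖z‖ (norm_nonneg z))

theorem EntireCoeff.entireSum_add (hc : EntireCoeff c) (hd : EntireCoeff d) (z : ℂ) :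
    entireSum (fun n => c n + d n) z = entireSum c z + entireSum d z := by
  rw [entireSum, entireSum, entireSum, ← (hc.summable z).tsum_add (hd.summable z)]
  refine tsum_congr fun n => ?_
  push_cast
  ring

theorem entireSum_const_mul (k : ℝ) (c : ℕ → ℝ) (z : ℂ) :
    entireSum (fun n => k * c n) z = k * entireSum c z := by
  rw [entireSum, entireSum, ← tsum_mul_left]
  refine tsum_congr fun n => ?_
  push_cast
  ring

theorem entireSum_ofReal (c : ℕ → ℝ) (x : ℝ) : entireSum c x = realSum c x := by
  rw [entireSum, realSum, Complex.ofReal_tsum]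
  push_cast
  rfl

theorem entireSum_zero (c : ℕ → ℝ) : entireSum c 0 = c 0 := by
  rw [entireSum, tsum_eq_single 0 (by intro n hn; simp [hn])]
  simp

theorem EntireCoeff.realSum_add (hc : EntireCoeff c) (hd : EntireCoeff d) (x : ℝ) :
    realSum (fun n => c n + d n) x = realSum c x + realSum d x := by
  have := hc.entireSum_add hd x
  simp only [entireSum_ofReal] at this
  exact_mod_cast this

theorem realSum_const_mul (k : ℝ) (c : ℕ → ℝ) (x : ℝ) :
    realSum (fun n => k * c n) x = k * realSum c x := by
  have := entireSum_const_mul k c x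
  simp only [entireSum_ofReal] at this
  exact_mod_cast this

theorem realSum_zero (c : ℕ → ℝ) : realSum c 0 = c 0 := by
  have := entireSum_zero c
  rw [← Complex.ofReal_zero, entireSum_ofReal] at this
  exact_mod_cast this

theorem EntireCoeff.differentiable (hc : EntireCoeff c) : Differentiable ℂ (entireSum c) := by
  intro z
  have h := Complex.differentiableOn_tsum_of_summable_norm (F := fun n (z : ℂ) => (c n : ℂ) * z ^ n)
    (U := Metric.ball 0 (‖z‖ + 1)) (hc (‖z‖ + 1) (by positivity)) (fun n => by fun_prop)
    Metric.isOpen_ball (fun n w hw => by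
      rw [norm_mul, norm_pow, Complex.norm_real, Real.norm_eq_abs]
      have : ‖w‖ ≤ ‖z‖ + 1 := by simpa using (mem_ball_zero_iff.1 hw).le
      gcongr)
  exact h.differentiableAt (Metric.isOpen_ball.mem_nhds (by simp))

theorem EntireCoeff.mul_deriv (hc : EntireCoeff c) (z : ℂ) :
    z * deriv (entireSum c) z = entireSum (fun n => n * c n) z := by
  have h := Complex.hasSum_deriv_of_summable_norm (F := fun n (z : ℂ) => (c n : ℂ) * z ^ n)
    (U := Metric.ball 0 (‖z‖ + 1)) (hc (‖z‖ + 1) (by positivity)) (fun n => by fun_prop)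
    Metric.isOpen_ball (fun n w hw => by
      rw [norm_mul, norm_pow, Complex.norm_real, Real.norm_eq_abs]
      have : ‖w‖ ≤ ‖z‖ + 1 := by simpa using (mem_ball_zero_iff.1 hw).le
      gcongr) (z := z) (by simp)
  rw [entireSum]
  refine ((h.mul_left z).tsum_eq.symm.trans ?_)
  refine tsum_congr fun n => ?_
  rw [deriv_const_mul_field, deriv_pow_field]
  cases n with
  | zero => simp
  | succ n => simp only [Nat.add_sub_cancel, pow_succ]; push_cast; ring

theorem EntireCoeff.hasDerivAt_real (hc : EntireCoeff c) (x : ℝ) :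
    HasDerivAt (realSum c) (deriv (entireSum c) x).re x := by
  have h := (hc.differentiable (x : ℂ)).hasDerivAt.real_of_complex
  refine h.congr_of_eventuallyEq (Eventually.of_forall fun y => ?_)
  simp [entireSum_ofReal]

theorem EntireCoeff.mul_deriv_real (hc : EntireCoeff c) (x : ℝ) :
    x * deriv (realSum c) x = realSum (fun n => n * c n) x := by
  rw [(hc.hasDerivAt_real x).deriv, ← Complex.re_ofReal_mul, hc.mul_deriv, entireSum_ofReal,
    Complex.ofReal_re]

theorem EntireCoeff.differentiable_real (hc : EntireCoeff c) : Differentiable ℝ (realSum c) :=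
  fun x => (hc.hasDerivAt_real x).differentiableAt

/-! ### Jensen approximants -/

/-- The coefficients of the Jensen polynomial `∑ m! / (m - n)! c n (z / m) ^ n`. -/
def jensenCoeff (c : ℕ → ℝ) (m n : ℕ) : ℝ := (m.descFactorial n / (m : ℝ) ^ n) * c n

theorem abs_jensenCoeff_le (c : ℕ → ℝ) (m n : ℕ) : |jensenCoeff c m n| ≤ |c n| := by
  rw [jensenCoeff, abs_mul]
  refine mul_le_of_le_one_left (abs_nonneg _) ?_
  rw [abs_of_nonneg (by positivity)]
  exact div_le_one_of_le₀ (by exact_mod_cast Nat.descFactorial_le_pow m n) (by positivity)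

theorem tendsto_jensenCoeff (c : ℕ → ℝ) (n : ℕ) :
    Tendsto (fun m => jensenCoeff c m n) atTop (𝓝 (c n)) := by
  have h := isEquivalent_descFactorial n
  rw [Asymptotics.isEquivalent_iff_tendsto_one
    ((eventually_gt_atTop 0).mono fun m hm => by positivity)] at h
  simpa [jensenCoeff] using h.mul_const (c n)

/-- Uniform convergence on disks of series with dominated, convergent coefficients. -/
theorem EntireCoeff.exists_tendsto_bound (hc : EntireCoeff c) {d : ℕ → ℕ → ℝ}
    (hd : ∀ m n, |d m n| ≤ |c n|) (hlim : ∀ n, Tendsto (fun m => d m n) atTop (𝓝 (c n)))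
    {R : ℝ} (hR : 0 ≤ R) :
    ∃ ε : ℕ → ℝ, Tendsto ε atTop (𝓝 0) ∧
      ∀ m (z : ℂ), ‖z‖ ≤ R → ‖entireSum (d m) z - entireSum c z‖ ≤ ε m := by
  have hb : ∀ m n, ‖|d m n - c n| * R ^ n‖ ≤ 2 * (|c n| * R ^ n) := by
    intro m n
    rw [Real.norm_eq_abs, abs_of_nonneg (by positivity), ← mul_assoc]
    refine mul_le_mul_of_nonneg_right ?_ (by positivity)
    linarith [abs_sub (d m n) (c n), hd m n]
  have hs : Summable fun n => 2 * (|c n| * R ^ n) := (hc R hR).mul_left 2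
  refine ⟨fun m => ∑' n, |d m n - c n| * R ^ n, ?_, fun m z hz => ?_⟩
  · have := tendsto_tsum_of_dominated_convergence (𝓕 := atTop)
      (f := fun m n => |d m n - c n| * R ^ n) (g := fun _ => 0) hs (fun n => ?_)
      (Eventually.of_forall fun m n => hb m n)
    · simpa using this
    · have h := (((hlim n).sub_const (c n)).abs).mul_const (R ^ n)
      simpa using h
  · have h1 := (hc.mono (hd m)).summable z
    rw [entireSum, entireSum, ← h1.tsum_sub (hc.summable z)]
    refine tsum_of_norm_bounded (Summable.of_norm_bounded hs (hb m)).hasSum fun n => ?_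
    rw [← sub_mul, norm_mul, norm_pow, ← Complex.ofReal_sub, Complex.norm_real, Real.norm_eq_abs]
    gcongr

theorem EntireCoeff.tendsto_entireSum (hc : EntireCoeff c) {d : ℕ → ℕ → ℝ}
    (hd : ∀ m n, |d m n| ≤ |c n|) (hlim : ∀ n, Tendsto (fun m => d m n) atTop (𝓝 (c n))) (z : ℂ) :
    Tendsto (fun m => entireSum (d m) z) atTop (𝓝 (entireSum c z)) := by
  obtain ⟨ε, h1, h2⟩ := hc.exists_tendsto_bound hd hlim (norm_nonneg z)
  rw [tendsto_iff_norm_sub_tendsto_zero]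
  exact squeeze_zero (fun _ => norm_nonneg _) (fun m => h2 m z le_rfl) h1

/-- The `m`-th Jensen polynomial of `∑ c n z ^ n`, rescaled. -/
def jensenApprox (c : ℕ → ℝ) (m : ℕ) : Polynomial ℂ :=
  (jensenPoly m fun n => n.factorial * c n).comp
    (Polynomial.C (((m : ℝ)⁻¹ : ℝ) : ℂ) * Polynomial.X)

theorem coeff_jensenApprox (c : ℕ → ℝ) (m n : ℕ) :
    (jensenApprox c m).coeff n = jensenCoeff c m n := by
  rw [jensenApprox, Polynomial.comp_C_mul_X_coeff, coeff_jensenPoly, jensenCoeff,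
    Nat.descFactorial_eq_factorial_mul_choose]
  push_cast
  rw [inv_pow]
  ring

theorem Polynomial.eval_eq_entireSum {P : Polynomial ℂ} (h : ∀ n, P.coeff n = c n) (z : ℂ) :
    P.eval z = entireSum c z := by
  rw [entireSum, Polynomial.eval_eq_sum_range, tsum_eq_sum (s := Finset.range (P.natDegree + 1))]
  · simp only [h]
  · intro n hn
    rw [← h, Polynomial.coeff_eq_zero_of_natDegree_lt (by simpa using hn), zero_mul]

theorem Polynomial.mul_eval_derivative_eq_entireSum {P : Polynomial ℂ} (h : ∀ n, P.coeff n = c n)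
    (z : ℂ) : z * P.derivative.eval z = entireSum (fun n => n * c n) z := by
  have : ∀ n, (Polynomial.X * P.derivative).coeff n = ((n * c n : ℝ) : ℂ) := by
    intro n
    cases n with
    | zero => simp
    | succ n =>
      rw [Polynomial.coeff_X_mul, Polynomial.coeff_derivative, h]
      push_cast
      ring
  rw [← Polynomial.eval_eq_entireSum this]
  simp

/-! ### Passage from Jensen polynomials to the entire function -/

/-- `∑ c n z ^ n` is entire, equal to `1` at `0`, and its Jensen polynomials have only positive
roots. -/
structure JensenPosRooted (c : ℕ → ℝ) : Prop where
  entire : EntireCoeff c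
  zero : c 0 = 1
  posRooted : ∀ m, PosRooted (jensenPoly m fun n => n.factorial * c n)

namespace JensenPosRooted

theorem posRooted_approx (h : JensenPosRooted c) {m : ℕ} (hm : 0 < m) :
    PosRooted (jensenApprox c m) :=
  (h.posRooted m).comp_C_mul_X (by positivity)

theorem tendsto_eval (h : JensenPosRooted c) (z : ℂ) :
    Tendsto (fun m => (jensenApprox c m).eval z) atTop (𝓝 (entireSum c z)) := by
  simp only [Polynomial.eval_eq_entireSum (coeff_jensenApprox c _)]
  exact h.entire.tendsto_entireSum (abs_jensenCoeff_le c) (tendsto_jensenCoeff c) z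

theorem tendsto_mul_eval_derivative (h : JensenPosRooted c) (z : ℂ) :
    Tendsto (fun m => z * (jensenApprox c m).derivative.eval z) atTop
      (𝓝 (entireSum (fun n => n * c n) z)) := by
  simp only [Polynomial.mul_eval_derivative_eq_entireSum (coeff_jensenApprox c _)]
  refine h.entire.nat_mul.tendsto_entireSum (fun m n => ?_)
    (fun n => (tendsto_jensenCoeff c n).const_mul _) z
  rw [abs_mul, abs_mul]
  exact mul_le_mul_of_nonneg_left (abs_jensenCoeff_le c m n) (abs_nonneg _)

/-- On `[0, R]` the series has a positive minimum, which eventually exceeds the uniform error of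
approximation. This makes the polynomial bounds available on the whole disk. -/
theorem eventually_eval_ne_zero (h : JensenPosRooted c) {R : ℝ} (hR : 0 ≤ R)
    (hpos : ∀ x, 0 ≤ x → x ≤ R → 0 < realSum c x) :
    ∀ᶠ m in atTop, ∀ x : ℝ, 0 < x → x ≤ R → (jensenApprox c m).eval (x : ℂ) ≠ 0 := by
  obtain ⟨ε, h1, h2⟩ := h.entire.exists_tendsto_bound (abs_jensenCoeff_le c) (tendsto_jensenCoeff c)
    hR
  obtain ⟨x₀, hx₀, hmin⟩ := isCompact_Icc.exists_isMinOn (Set.nonempty_Icc.2 hR)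
    h.entire.differentiable_real.continuous.continuousOn
  filter_upwards [h1.eventually (gt_mem_nhds (hpos x₀ hx₀.1 hx₀.2))] with m hm x hx hxR h0
  have h3 := h2 m x (by simpa [abs_of_pos hx] using hxR)
  rw [← Polynomial.eval_eq_entireSum (coeff_jensenApprox c m), h0, zero_sub, norm_neg,
    entireSum_ofReal, Complex.norm_real, Real.norm_eq_abs] at h3
  have h4 := hmin (Set.mem_Icc.2 ⟨hx.le, hxR⟩)
  simp only [Set.mem_ofPred_eq] at h4
  linarith [le_abs_self (realSum c x)]

section Bounds

variable {R : ℝ}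

theorem realSum_norm_le (h : JensenPosRooted c)
    (hpos : ∀ x, 0 ≤ x → x ≤ R → 0 < realSum c x) {w : ℂ} (hw : ‖w‖ ≤ R) : realSum c ‖w‖ ≤ ‖entireSum c w‖ := by
  have h1 : ‖entireSum c (‖w‖ : ℂ)‖ ≤ ‖entireSum c w‖ := by
    refine le_of_tendsto_of_tendsto (h.tendsto_eval _).norm (h.tendsto_eval w).norm ?_
    filter_upwards [h.eventually_eval_ne_zero ((norm_nonneg w).trans hw) hpos, eventually_gt_atTop 0]
      with m hm hm0
    exact (h.posRooted_approx hm0).norm_eval_le hm hw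
  rw [entireSum_ofReal, Complex.norm_real] at h1
  exact (le_abs_self _).trans h1

theorem entireSum_ne_zero (h : JensenPosRooted c)
    (hpos : ∀ x, 0 ≤ x → x ≤ R → 0 < realSum c x) {w : ℂ} (hw : ‖w‖ ≤ R) : entireSum c w ≠ 0 := by
  have h1 := h.realSum_norm_le hpos hw
  have h2 := hpos ‖w‖ (norm_nonneg w) hw
  exact norm_pos_iff.1 (h2.trans_le h1)

theorem div_le_re_div (h : JensenPosRooted c)
    (hpos : ∀ x, 0 ≤ x → x ≤ R → 0 < realSum c x) {w : ℂ} (hw : ‖w‖ ≤ R) :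
    realSum (fun n => n * c n) ‖w‖ / realSum c ‖w‖
      ≤ (entireSum (fun n => n * c n) w / entireSum c w).re := by
  have hw' : ‖(‖w‖ : ℂ)‖ ≤ R := by simpa using hw
  have h1 : (entireSum (fun n => n * c n) (‖w‖ : ℂ) / entireSum c (‖w‖ : ℂ)).re
      ≤ (entireSum (fun n => n * c n) w / entireSum c w).re := by
    refine le_of_tendsto_of_tendsto
      (Complex.continuous_re.continuousAt.tendsto.comp
        ((h.tendsto_mul_eval_derivative _).div (h.tendsto_eval _) (h.entireSum_ne_zero hpos hw')))
      (Complex.continuous_re.continuousAt.tendsto.comp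
        ((h.tendsto_mul_eval_derivative w).div (h.tendsto_eval w) (h.entireSum_ne_zero hpos hw))) ?_
    filter_upwards [h.eventually_eval_ne_zero ((norm_nonneg w).trans hw) hpos, eventually_gt_atTop 0]
      with m hm hm0
    exact (h.posRooted_approx hm0).re_mul_logDeriv_le hm hw
  rwa [entireSum_ofReal, entireSum_ofReal, ← Complex.ofReal_div, Complex.ofReal_re] at h1

theorem div_le_mul (h : JensenPosRooted c)
    (hpos : ∀ x, 0 ≤ x → x ≤ R → 0 < realSum c x) {x : ℝ} (hx0 : 0 ≤ x) (hx : x ≤ R) :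
    realSum (fun n => n * c n) x / realSum c x ≤ x * c 1 := by
  have hx' : ‖(x : ℂ)‖ ≤ R := by simpa [abs_of_nonneg hx0] using hx
  have h1 : (entireSum (fun n => n * c n) (x : ℂ) / entireSum c (x : ℂ)).re ≤ x * c 1 := by
    refine le_of_tendsto
      (Complex.continuous_re.continuousAt.tendsto.comp
        ((h.tendsto_mul_eval_derivative _).div (h.tendsto_eval _) (h.entireSum_ne_zero hpos hx'))) ?_
    filter_upwards [h.eventually_eval_ne_zero (hx0.trans hx) hpos, eventually_gt_atTop 0]
      with m hm hm0
    have h2 := (h.posRooted_approx hm0).re_mul_logDeriv_le_mul hm hx0 hx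
    have e0 : (jensenApprox c m).eval 0 = 1 := by
      rw [← Polynomial.coeff_zero_eq_eval_zero, coeff_jensenApprox, jensenCoeff, h.zero]
      simp
    have e1 : (jensenApprox c m).derivative.eval 0 = c 1 := by
      rw [← Polynomial.coeff_zero_eq_eval_zero, Polynomial.coeff_derivative, coeff_jensenApprox,
        jensenCoeff]
      have : (m : ℝ) ≠ 0 := by positivity
      simp [this]
    rw [e0, e1, div_one, Complex.ofReal_re] at h2
    exact h2
  rwa [entireSum_ofReal, entireSum_ofReal, ← Complex.ofReal_div, Complex.ofReal_re] at h1

end Bounds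

end JensenPosRooted

/-! ### First positive zeros on the real axis -/

theorem exists_first_zero {f : ℝ → ℝ} (hf : Continuous f) (h0 : 0 < f 0) {y : ℝ} (hy : 0 ≤ y)
    (hfy : f y ≤ 0) : ∃ z, 0 < z ∧ z ≤ y ∧ f z = 0 ∧ ∀ x, 0 ≤ x → x < z → 0 < f x := by
  have hK : IsCompact (Set.Icc 0 y ∩ f ⁻¹' Set.Iic 0) :=
    isCompact_Icc.inter_right (isClosed_Iic.preimage hf)
  obtain ⟨z, ⟨⟨hz0, hzy⟩, hfz⟩, hz⟩ := hK.exists_isLeast ⟨y, ⟨hy, le_rfl⟩, hfy⟩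
  have hlt : ∀ x, 0 ≤ x → x < z → 0 < f x := by
    intro x hx hxz
    by_contra! h
    exact absurd (hz ⟨⟨hx, hxz.le.trans hzy⟩, h⟩) (not_le.2 hxz)
  obtain ⟨x, ⟨hx0, hxz⟩, hfx⟩ := intermediate_value_Icc' hz0 hf.continuousOn ⟨hfz, h0.le⟩
  have hxz' : x = z := by
    by_contra hne
    exact (hlt x hx0 (lt_of_le_of_ne hxz hne)).ne' hfx
  subst hxz'
  refine ⟨x, lt_of_le_of_ne hz0 ?_, hzy, hfx, hlt⟩
  rintro rfl
  exact h0.ne' hfx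

variable {c : ℕ → ℝ}

/-- If `C φ + x φ' > 0` then `x ^ C φ` increases. -/
theorem EntireCoeff.rpow_mul_realSum_lt (hc : EntireCoeff c) {C x y : ℝ} (hx : 0 < x) (hxy : x < y)
    (h : ∀ t, x < t → t < y → 0 < C * realSum c t + realSum (fun n => n * c n) t) :
    x ^ C * realSum c x < y ^ C * realSum c y := by
  have hd : ∀ t, 0 < t → HasDerivAt (fun t => t ^ C * realSum c t)
      (C * t ^ (C - 1) * realSum c t + t ^ C * deriv (realSum c) t) t := fun t ht =>
    (Real.hasDerivAt_rpow_const (Or.inl ht.ne')).mul (hc.differentiable_real t).hasDerivAt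
  refine strictMonoOn_of_deriv_pos (convex_Icc x y)
    (fun t ht => (hd t (hx.trans_le ht.1)).continuousAt.continuousWithinAt) ?_
    (Set.left_mem_Icc.2 hxy.le) (Set.right_mem_Icc.2 hxy.le) hxy
  intro t ht
  rw [interior_Icc] at ht
  have ht0 : 0 < t := hx.trans ht.1
  rw [(hd t ht0).deriv]
  have h1 := h t ht.1 ht.2
  rw [← hc.mul_deriv_real] at h1
  have h2 : t ^ C = t ^ (C - 1) * t := by
    rw [← Real.rpow_add_one ht0.ne']; ring_nf
  rw [h2]
  have : 0 < t ^ (C - 1) * (C * realSum c t + t * deriv (realSum c) t) := by positivity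
  linarith

/-- The first positive zero of `C φ + x φ'` exists and precedes the first zero of `φ`. -/
theorem JensenPosRooted.exists_first_zero (h : JensenPosRooted c) (h1 : c 1 < 0) {C : ℝ}
    (hC : 0 < C) :
    ∃ ρ, 0 < ρ ∧ C * realSum c ρ + realSum (fun n => n * c n) ρ = 0 ∧
      (∀ x, 0 ≤ x → x ≤ ρ → 0 < realSum c x) ∧
      ∀ x, 0 ≤ x → x < ρ → 0 < C * realSum c x + realSum (fun n => n * c n) x := by
  have hcont := h.entire.differentiable_real.continuous
  have hcont' := h.entire.nat_mul.differentiable_real.continuous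
  have h0 : 0 < realSum c 0 := by rw [realSum_zero, h.zero]; exact one_pos
  -- While `C φ + x φ' > 0`, the function `x ^ C φ` increases, so from its positive value at half
  -- the first zero of `φ` it cannot fall to zero there.
  have key : ∀ y, 0 ≤ y → (∀ x, 0 < x → x < y →
      0 < C * realSum c x + realSum (fun n => n * c n) x) →
      ∀ x, 0 ≤ x → x ≤ y → 0 < realSum c x := by
    intro y hy hD x hx hxy
    by_contra! hneg
    obtain ⟨z, hz0, hzx, hfz, hz⟩ := _root_.exists_first_zero hcont h0 hx hneg
    have h2 := h.entire.rpow_mul_realSum_lt (C := C) (half_pos hz0) (half_lt_self hz0)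
      fun t ht1 ht2 => hD t ((half_pos hz0).trans ht1) (by linarith)
    rw [hfz, mul_zero] at h2
    have := mul_pos (Real.rpow_pos_of_pos (half_pos hz0) C) (hz _ (half_pos hz0).le
      (half_lt_self hz0))
    linarith
  have hex : ∃ y, 0 ≤ y ∧ C * realSum c y + realSum (fun n => n * c n) y ≤ 0 := by
    by_contra! hD
    -- At `x = C / -c 1` the bound `x φ'/φ ≤ x c₁` equals `-C`, so `C φ + x φ'` cannot still be
    -- positive.
    have hx : 0 ≤ C / -c 1 := by have : 0 < -c 1 := by linarith
                                 positivity
    have hφ := key (C / -c 1) hx fun x hx _ => hD x hx.le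
    have h2 := h.div_le_mul hφ hx le_rfl
    have h3 := hφ _ hx le_rfl
    rw [div_le_iff₀ h3] at h2
    have h4 := hD _ hx
    have h5 : C / -c 1 * c 1 = -C := by
      have := h1.ne
      field_simp
    rw [h5] at h2
    linarith
  obtain ⟨y, hy, hDy⟩ := hex
  obtain ⟨ρ, hρ, _, hDρ, hlt⟩ := _root_.exists_first_zero
    (f := fun x => C * realSum c x + realSum (fun n => n * c n) x)
    ((continuous_const.mul hcont).add hcont')
    (by simp only [realSum_zero, h.zero]; simpa using hC) hy hDy
  exact ⟨ρ, hρ, hDρ, key ρ hρ.le fun x hx hxy => hlt x hx.le hxy, hlt⟩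

/-! ### Analytic branches and the radius of starlikeness -/

/-- `L` is a primitive of `E'/E`, and `E exp(-L)` has zero derivative. It supplies the branch of the
power `κ`. -/
theorem exists_log_on_ball {E : ℂ → ℂ} (hE : Differentiable ℂ E) (h0 : E 0 = 1) {R : ℝ}
    (hR : 0 < R) (hne : ∀ w ∈ Metric.ball (0 : ℂ) R, E w ≠ 0) :
    ∃ L : ℂ → ℂ, L 0 = 0 ∧ ∀ w ∈ Metric.ball (0 : ℂ) R,
      HasDerivAt L (deriv E w / E w) w ∧ Complex.exp (L w) = E w := by
  have hd : DifferentiableOn ℂ (fun w => deriv E w / E w) (Metric.ball 0 R) :=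
    (hE.contDiff (n := 2)).differentiable_deriv_two.differentiableOn.div hE.differentiableOn hne
  obtain ⟨L, hL0, hL⟩ := hd.isExactOn_ball.with_val_at 0 0
  refine ⟨L, hL0, fun w hw => ⟨hL w hw, ?_⟩⟩
  have hder : ∀ z ∈ Metric.ball (0 : ℂ) R, HasDerivAt (fun z => E z * Complex.exp (-L z)) 0 z := by
    intro z hz
    convert! (hE z).hasDerivAt.mul (hL z hz).neg.cexp using 1
    have := hne z hz
    field_simp
    ring
  have hconst := Metric.isOpen_ball.is_const_of_deriv_eq_zero
    (convex_ball (0 : ℂ) R).isPreconnected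
    (fun z hz => (hder z hz).differentiableAt.differentiableWithinAt)
    (fun z hz => (hder z hz).deriv) hw (Metric.mem_ball_self hR)
  simp only [hL0, h0, neg_zero, Complex.exp_zero, mul_one] at hconst
  rw [Complex.exp_neg, ← div_eq_mul_inv, div_eq_one_iff_eq (Complex.exp_ne_zero _)] at hconst
  exact hconst.symm

/-- Two analytic branches of the same formula coincide. -/
theorem IsAnalyticBranchOn.eqOn {f F G : ℂ → ℂ} {r : ℝ} (hr : 0 < r)
    (hF : IsAnalyticBranchOn f F r) (hG : IsAnalyticBranchOn f G r) :
    Set.EqOn F G (Metric.ball 0 r) := by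
  refine (hF.1.analyticOnNhd Metric.isOpen_ball).eqOn_of_preconnected_of_frequently_eq
    (hG.1.analyticOnNhd Metric.isOpen_ball) (convex_ball (0 : ℂ) r).isPreconnected
    (Metric.mem_ball_self hr) ?_
  have ht : Tendsto (fun x : ℝ => (x : ℂ)) (𝓝[>] 0) (𝓝[≠] 0) := by
    refine tendsto_nhdsWithin_iff.2 ⟨?_, ?_⟩
    · exact (Complex.continuous_ofReal.tendsto' 0 0 (by simp)).mono_left nhdsWithin_le_nhds
    · filter_upwards [self_mem_nhdsWithin] with x hx
      simpa using (ne_of_gt hx)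
  refine ht.frequently (Eventually.frequently ?_)
  filter_upwards [hF.2, hG.2] with x h1 h2
  rw [h1, h2]

/-- Inside `|z| < ρ` the quotient is bounded below by its value on the positive ray, where the
hypotheses make it exceed `β`. Any branch on a larger disk agrees with the constructed one on this
disk, so by continuity its quotient at `ρ` equals `β`, contradicting strict inequality. -/
theorem JensenPosRooted.isRadiusOfStarlikeness (h : JensenPosRooted c) {κ β ρ : ℝ} (hκ : 0 < κ)
    {p : ℕ} (hp : p ≠ 0) (hρ : 0 < ρ)
    (hD : (1 - β) * realSum c (ρ ^ p) + κ * p * realSum (fun n => n * c n) (ρ ^ p) = 0)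
    (hφ : ∀ x, 0 ≤ x → x ≤ ρ ^ p → 0 < realSum c x)
    (hlt : ∀ x, 0 ≤ x → x < ρ ^ p →
      0 < (1 - β) * realSum c x + κ * p * realSum (fun n => n * c n) x)
    {f : ℂ → ℂ} (hf : ∀ᶠ x : ℝ in 𝓝[>] 0, f x = ((x * realSum c (x ^ p) ^ κ : ℝ) : ℂ)) :
    IsRadiusOfStarlikeness β f ρ := by
  have hE := h.entire.differentiable
  have hRp : 0 < ρ ^ p := by positivity
  obtain ⟨L, hL0, hL⟩ := exists_log_on_ball hE (by rw [entireSum_zero, h.zero]; simp) hRp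
    fun w hw => h.entireSum_ne_zero hφ (mem_ball_zero_iff.1 hw).le
  have hpow : ∀ z ∈ Metric.ball (0 : ℂ) ρ, z ^ p ∈ Metric.ball (0 : ℂ) (ρ ^ p) := by
    intro z hz
    rw [mem_ball_zero_iff] at hz ⊢
    rw [norm_pow]
    exact pow_lt_pow_left₀ hz (norm_nonneg z) hp
  set F : ℂ → ℂ := fun z => z * Complex.exp (κ * L (z ^ p)) with hF
  have hder : ∀ z ∈ Metric.ball (0 : ℂ) ρ, HasDerivAt F (Complex.exp (κ * L (z ^ p)) *
      (1 + κ * p * (z ^ p * deriv (entireSum c) (z ^ p)) / entireSum c (z ^ p))) z := by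
    intro z hz
    obtain ⟨h1, -⟩ := hL _ (hpow z hz)
    have h2 : HasDerivAt (fun z => L (z ^ p))
        (deriv (entireSum c) (z ^ p) / entireSum c (z ^ p) * (p * z ^ (p - 1))) z :=
      HasDerivAt.comp z h1 (hasDerivAt_pow p z)
    convert! (hasDerivAt_id z).mul (h2.const_mul (κ : ℂ)).cexp using 1
    have h3 : z ^ p = z * z ^ (p - 1) := (mul_pow_sub_one hp z).symm
    simp only [id]
    rw [← sub_eq_zero]
    generalize deriv (entireSum c) (z ^ p) = A
    generalize entireSum c (z ^ p) = B
    generalize Complex.exp (κ * L (z ^ p)) = e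
    rw [h3]
    ring
  have hlog : ∀ z ∈ Metric.ball (0 : ℂ) ρ, z ≠ 0 → F z ≠ 0 ∧ z * deriv F z / F z =
      1 + κ * p * (entireSum (fun n => n * c n) (z ^ p) / entireSum c (z ^ p)) := by
    intro z hz hz0
    refine ⟨mul_ne_zero hz0 (Complex.exp_ne_zero _), ?_⟩
    rw [(hder z hz).deriv, h.entire.mul_deriv, hF, mul_div_mul_left _ _ hz0,
      mul_div_cancel_left₀ _ (Complex.exp_ne_zero _), mul_div_assoc]
  have hbranch : IsAnalyticBranchOn f F ρ := by
    refine ⟨fun z hz => (hder z hz).differentiableAt.differentiableWithinAt, ?_⟩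
    -- Near `0` the imaginary part of `L` lies within `(-π, π)`, so `L` is the principal logarithm
    -- and `F` takes the principal values.
    have hcont : Tendsto (fun x : ℝ => (L ((x : ℂ) ^ p)).im) (𝓝[>] 0) (𝓝 0) := by
      have h1 : ContinuousAt L 0 := (hL 0 (Metric.mem_ball_self hRp)).1.continuousAt
      have h2 : Tendsto (fun x : ℝ => (x : ℂ) ^ p) (𝓝 0) (𝓝 0) :=
        Continuous.tendsto' (by fun_prop) _ _ (by simp [hp])
      have h3 := (Complex.continuous_im.tendsto _).comp (h1.tendsto.comp h2)
      rw [hL0] at h3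
      exact h3.mono_left nhdsWithin_le_nhds
    filter_upwards [hf, hcont.eventually (lt_mem_nhds (neg_lt_zero.2 Real.pi_pos)),
      hcont.eventually (gt_mem_nhds Real.pi_pos), self_mem_nhdsWithin,
      nhdsWithin_le_nhds (gt_mem_nhds hρ)] with x h1 h2 h3 hx0 hxρ
    have hx0' : 0 < x := hx0
    have hxb : (x : ℂ) ∈ Metric.ball (0 : ℂ) ρ := by simpa [abs_of_pos hx0'] using hxρ
    have h4 := (hL _ (hpow _ hxb)).2
    have hxp : 0 < realSum c (x ^ p) :=
      hφ _ (by positivity) (pow_le_pow_left₀ hx0'.le hxρ.le p)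
    have h5 : L ((x : ℂ) ^ p) = (Real.log (realSum c (x ^ p)) : ℂ) := by
      rw [← Complex.log_exp h2 h3.le, h4, ← Complex.ofReal_pow, entireSum_ofReal,
        Complex.ofReal_log hxp.le]
    rw [h1, hF]
    simp only
    rw [h5, Real.rpow_def_of_pos hxp]
    push_cast
    rw [mul_comm (κ : ℂ)]
  have hstar : ρ ∈ starlikeRadii β f := by
    refine ⟨hρ, F, hbranch, fun z hz hz0 => ⟨(hlog z hz hz0).1, ?_⟩⟩
    rw [(hlog z hz hz0).2]
    have hzp : ‖z ^ p‖ < ρ ^ p := mem_ball_zero_iff.1 (hpow z hz)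
    have h1 := h.div_le_re_div hφ hzp.le
    have h2 := hlt _ (norm_nonneg _) hzp
    have h3 := hφ _ (norm_nonneg _) hzp.le
    have h4 : -(1 - β) < κ * p *
        (realSum (fun n => n * c n) ‖z ^ p‖ / realSum c ‖z ^ p‖) := by
      rw [← mul_div_assoc, lt_div_iff₀ h3]
      linarith
    have h5 : ∀ w : ℂ, (1 + (κ : ℂ) * p * w).re = 1 + κ * p * w.re := by
      intro w
      simp [mul_assoc]
    rw [h5]
    have : 0 ≤ κ * p := by positivity
    nlinarith [mul_le_mul_of_nonneg_left h1 this]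
  refine IsGreatest.isLUB ⟨hstar, ?_⟩
  rintro r ⟨hr0, G, hG, hGs⟩
  by_contra! hlt'
  have hGρ : IsAnalyticBranchOn f G ρ :=
    ⟨hG.1.mono (Metric.ball_subset_ball hlt'.le), hG.2⟩
  have heq := hGρ.eqOn hρ hbranch
  have hρr : (ρ : ℂ) ∈ Metric.ball (0 : ℂ) r := by simpa [abs_of_pos hρ] using hlt'
  obtain ⟨hG0, hGβ⟩ := hGs ρ hρr (by exact_mod_cast hρ.ne')
  have hGan := (hG.1.analyticOnNhd Metric.isOpen_ball) ρ hρr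
  have hG1 : Tendsto (fun x : ℝ => (x : ℂ) * deriv G x / G x) (𝓝[<] ρ)
      (𝓝 (ρ * deriv G ρ / G ρ)) := by
    have h1 : ContinuousAt (fun z : ℂ => z * deriv G z / G z) ρ :=
      (continuousAt_id.mul hGan.deriv.continuousAt).div hGan.continuousAt hG0
    exact (h1.tendsto.comp (Complex.continuous_ofReal.tendsto ρ)).mono_left nhdsWithin_le_nhds
  have hEne : entireSum c ((ρ : ℂ) ^ p) ≠ 0 :=
    h.entireSum_ne_zero hφ (by rw [norm_pow, Complex.norm_real, Real.norm_of_nonneg hρ.le])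
  have hG2 : Tendsto (fun x : ℝ => (x : ℂ) * deriv G x / G x) (𝓝[<] ρ) (𝓝 β) := by
    have h1 : ContinuousAt (fun z : ℂ => 1 + κ * p *
        (entireSum (fun n => n * c n) (z ^ p) / entireSum c (z ^ p))) ρ := by
      have hc1 : Continuous fun z : ℂ => entireSum (fun n => n * c n) (z ^ p) :=
        h.entire.nat_mul.differentiable.continuous.comp (continuous_pow p)
      have hc2 : Continuous fun z : ℂ => entireSum c (z ^ p) :=
        hE.continuous.comp (continuous_pow p)
      exact continuousAt_const.add
        (continuousAt_const.mul (hc1.continuousAt.div hc2.continuousAt hEne))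
    have h2 : 1 + κ * p * (entireSum (fun n => n * c n) ((ρ : ℂ) ^ p) /
        entireSum c ((ρ : ℂ) ^ p)) = β := by
      rw [← Complex.ofReal_pow, entireSum_ofReal, entireSum_ofReal]
      have h3 := hφ _ hRp.le le_rfl
      have h4 : 1 + κ * p * (realSum (fun n => n * c n) (ρ ^ p) / realSum c (ρ ^ p)) = β := by
        field_simp
        linarith
      exact_mod_cast h4
    have h3 := (h1.tendsto.comp (Complex.continuous_ofReal.tendsto ρ)).mono_left
      (nhdsWithin_le_nhds (s := Set.Iio ρ))
    rw [h2] at h3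
    refine h3.congr' ?_
    filter_upwards [self_mem_nhdsWithin, nhdsWithin_le_nhds (lt_mem_nhds hρ)] with x hx hx0
    have hxb : (x : ℂ) ∈ Metric.ball (0 : ℂ) ρ := by simpa [abs_of_pos hx0] using hx
    have hd : deriv G x = deriv F x :=
      (heq.eventuallyEq_of_mem (Metric.isOpen_ball.mem_nhds hxb)).deriv_eq
    rw [hd, heq hxb, (hlog x hxb (by exact_mod_cast hx0.ne')).2]
    rfl
  have := tendsto_nhds_unique hG1 hG2
  rw [this, Complex.ofReal_re] at hGβ
  exact lt_irrefl _ hGβ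

theorem JensenPosRooted.exists_radius {c : ℕ → ℝ} (h : JensenPosRooted c) (h1 : c 1 < 0)
    {κ β : ℝ} (hκ : 0 < κ) (hβ : β < 1) {p : ℕ} (hp : p ≠ 0) :
    ∃ ρ, 0 < ρ ∧ 0 < realSum c (ρ ^ p) ∧
      (1 - β) * realSum c (ρ ^ p) + κ * p * realSum (fun n => n * c n) (ρ ^ p) = 0 ∧
      (∀ r, 0 < r → (1 - β) * realSum c (r ^ p) + κ * p * realSum (fun n => n * c n) (r ^ p) = 0 →
        ρ ≤ r) ∧
      ∀ f : ℂ → ℂ, (∀ x : ℝ, 0 < x → 0 < realSum c (x ^ p) →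
        f x = ((x * realSum c (x ^ p) ^ κ : ℝ) : ℂ)) → IsRadiusOfStarlikeness β f ρ := by
  have hk : 0 < κ * p := by positivity
  -- Dividing `(1-β) φ + κ p x φ'` by `κ p` gives this `C`; the radius is then the `p`-th root of
  -- `y`.
  obtain ⟨y, hy, hDy, hφ, hlt⟩ := h.exists_first_zero h1 (C := (1 - β) / (κ * p))
    (div_pos (by linarith) hk)
  have hD : ∀ x, (1 - β) * realSum c x + κ * p * realSum (fun n => n * c n) x =
      κ * p * ((1 - β) / (κ * p) * realSum c x + realSum (fun n => n * c n) x) := by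
    intro x
    field_simp
  have hρy : (y ^ (p⁻¹ : ℝ)) ^ p = y := Real.rpow_inv_natCast_pow hy.le hp
  have hρ : 0 < y ^ (p⁻¹ : ℝ) := Real.rpow_pos_of_pos hy _
  generalize y ^ (p⁻¹ : ℝ) = ρ at hρy hρ
  subst hρy
  have hD0 : (1 - β) * realSum c (ρ ^ p) + κ * p * realSum (fun n => n * c n) (ρ ^ p) = 0 := by
    rw [hD, hDy, mul_zero]
  have hD1 : ∀ x, 0 ≤ x → x < ρ ^ p →
      0 < (1 - β) * realSum c x + κ * p * realSum (fun n => n * c n) x := fun x hx hxρ => by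
    rw [hD]
    exact mul_pos hk (hlt x hx hxρ)
  refine ⟨ρ, hρ, hφ _ hy.le le_rfl, hD0, fun r hr h0 => ?_, fun f hf => ?_⟩
  · by_contra! hrρ
    exact (hD1 _ (by positivity) (pow_lt_pow_left₀ hrρ hr.le hp)).ne' h0
  · refine h.isRadiusOfStarlikeness hκ hp hρ hD0 hφ hD1 ?_
    filter_upwards [self_mem_nhdsWithin, nhdsWithin_le_nhds (gt_mem_nhds hρ)] with x hx0 hx
    have hx0' : 0 < x := hx0
    exact hf x hx0' (hφ _ (by positivity) (pow_le_pow_left₀ hx0'.le hx.le p))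

/-! ### Derivatives of the Bessel function -/

/-- The coefficients of `J_ν(z) / (z / 2) ^ ν` as a power series in `z ^ 2`. -/
def besselCoeff (ν : ℝ) (n : ℕ) : ℝ := laguerreCoeff ν n / (n.factorial * 4 ^ n)

theorem entireCoeff_besselCoeff {ν : ℝ} (hν : 0 ≤ ν) : EntireCoeff (besselCoeff ν) := by
  -- This Gamma lower bound lets the exponential series dominate the coefficients.
  have hG : ∀ n : ℕ, Real.Gamma (ν + 1) ≤ Real.Gamma (n + ν + 1) := by
    intro n
    induction n with
    | zero => simp
    | succ n ih =>
      have hn : (0 : ℝ) ≤ n := n.cast_nonneg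
      have e : Real.Gamma ((n + 1 : ℕ) + ν + 1) = (n + ν + 1) * Real.Gamma (n + ν + 1) := by
        rw [← Real.Gamma_add_one (by linarith)]; congr 1; push_cast; ring
      rw [e]
      have := Real.Gamma_pos_of_pos (by linarith : 0 < (n : ℝ) + ν + 1)
      nlinarith [mul_nonneg (by linarith : 0 ≤ (n : ℝ) + ν) this.le]
  intro R hR
  refine Summable.of_nonneg_of_le (fun _ => by positivity) (fun n => ?_)
    ((Real.summable_pow_div_factorial R).mul_left (Real.Gamma (ν + 1))⁻¹)
  have h0 : 0 < Real.Gamma (ν + 1) := Real.Gamma_pos_of_pos (by linarith)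
  have h1 : 0 < Real.Gamma (n + ν + 1) := h0.trans_le (hG n)
  rw [besselCoeff, laguerreCoeff, abs_div, abs_div, abs_pow, abs_neg, abs_one, one_pow,
    abs_of_pos h1, abs_of_pos (by positivity : (0 : ℝ) < n.factorial * 4 ^ n), one_div, div_mul_eq_mul_div,
    mul_div_assoc]
  have h4 : (1 : ℝ) ≤ 4 ^ n := one_le_pow₀ (by norm_num)
  have hf : (n.factorial : ℝ) ≤ n.factorial * 4 ^ n := le_mul_of_one_le_right (by positivity) h4
  gcongr
  exact hG n

/-- The coefficients of `z ^ k J_ν^(k)(z) / (z / 2) ^ ν` as a power series in `z ^ 2`. -/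
def besselDerivCoeff (ν : ℝ) (k n : ℕ) : ℝ :=
  (∏ j ∈ Finset.range k, (ν + 2 * n - j)) * besselCoeff ν n

theorem besselDerivCoeff_succ (ν : ℝ) (k : ℕ) : besselDerivCoeff ν (k + 1) =
    fun n => (ν - k) * besselDerivCoeff ν k n + 2 * (n * besselDerivCoeff ν k n) := by
  ext n
  rw [besselDerivCoeff, besselDerivCoeff, Finset.prod_range_succ]
  ring

theorem entireCoeff_besselDerivCoeff {ν : ℝ} (hν : 0 ≤ ν) (k : ℕ) :
    EntireCoeff (besselDerivCoeff ν k) := by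
  induction k with
  | zero => exact (entireCoeff_besselCoeff hν).mono fun n => by simp [besselDerivCoeff]
  | succ k ih =>
    rw [besselDerivCoeff_succ]
    exact (ih.const_mul _).add (ih.nat_mul.const_mul _)

theorem besselJ_eq {ν : ℝ} {z : ℂ} (hz : z ≠ 0) :
    besselJ ν z = (z / 2) ^ (ν : ℂ) * entireSum (besselCoeff ν) (z ^ 2) := by
  rw [besselJ, entireSum, ← tsum_mul_left]
  refine tsum_congr fun n => ?_
  rw [Complex.cpow_add _ _ (by simpa using hz), besselCoeff, laguerreCoeff]
  have h1 : (z / 2) ^ (2 * (n : ℂ)) = (z ^ 2) ^ n / 4 ^ n := by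
    rw [← Nat.cast_ofNat, ← Nat.cast_mul, Complex.cpow_natCast, pow_mul, div_pow, div_pow]
    norm_num
  rw [h1]
  push_cast
  simp only [div_eq_mul_inv, mul_inv]
  ring

/-- Each derivative of `z^(ν+2n-k)` brings down `ν+2n-k`. The slit plane is open, so the formula for
one order can be differentiated to give the next. -/
theorem iteratedDeriv_besselJ {ν : ℝ} (hν : 0 ≤ ν) (k : ℕ) {z : ℂ} (hz : z ∈ Complex.slitPlane) :
    iteratedDeriv k (besselJ ν) z =
      (z / 2) ^ (ν : ℂ) * entireSum (besselDerivCoeff ν k) (z ^ 2) / z ^ k := by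
  induction k generalizing z with
  | zero =>
    rw [iteratedDeriv_zero, besselJ_eq (Complex.slitPlane_ne_zero hz), pow_zero, div_one]
    simp [besselDerivCoeff, entireSum]
  | succ k ih =>
    have hz0 := Complex.slitPlane_ne_zero hz
    have hc := entireCoeff_besselDerivCoeff hν k
    have hev : iteratedDeriv k (besselJ ν) =ᶠ[𝓝 z]
        fun z => (z / 2) ^ (ν : ℂ) * entireSum (besselDerivCoeff ν k) (z ^ 2) / z ^ k := by
      filter_upwards [Complex.isOpen_slitPlane.mem_nhds hz] with w hw using ih hw
    have hz2 : z / 2 ∈ Complex.slitPlane := by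
      rw [Complex.mem_slitPlane_iff] at hz ⊢
      simpa using hz
    have h1 : HasDerivAt (fun z : ℂ => (z / 2) ^ (ν : ℂ)) (ν * (z / 2) ^ (ν : ℂ) / z) z := by
      have := ((hasDerivAt_id z).div_const 2).cpow_const (c := (ν : ℂ)) hz2
      convert! this using 1
      rw [id, Complex.cpow_sub _ _ (by simpa using hz0), Complex.cpow_one]
      field_simp
    have h2 : HasDerivAt (fun z : ℂ => entireSum (besselDerivCoeff ν k) (z ^ 2))
        (deriv (entireSum (besselDerivCoeff ν k)) (z ^ 2) * (2 * z)) z := by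
      have h3 := HasDerivAt.comp z (hc.differentiable (z ^ 2)).hasDerivAt (hasDerivAt_pow 2 z)
      simpa using! h3
    refine (congrFun iteratedDeriv_succ z).trans (hev.deriv_eq.trans
      (((h1.mul h2).div (hasDerivAt_pow k z) (pow_ne_zero k hz0)).deriv.trans ?_))
    rw [besselDerivCoeff_succ,
      (hc.const_mul _).entireSum_add (hc.nat_mul.const_mul _), entireSum_const_mul,
      entireSum_const_mul, ← hc.mul_deriv]
    simp only [Pi.mul_apply]
    generalize (z / 2) ^ (ν : ℂ) = t
    generalize deriv (entireSum (besselDerivCoeff ν k)) (z ^ 2) = A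
    generalize entireSum (besselDerivCoeff ν k) (z ^ 2) = B
    have hk : (k : ℂ) * z ^ (k - 1) = k * z ^ k / z := by
      cases k with
      | zero => simp
      | succ k => rw [Nat.add_sub_cancel, pow_succ]; field_simp
    rw [hk]
    push_cast
    field_simp
    ring

theorem iteratedDeriv_besselJ_ofReal {ν : ℝ} (hν : 0 ≤ ν) (k : ℕ) {x : ℝ} (hx : 0 < x) :
    iteratedDeriv k (besselJ ν) x =
      (((x / 2) ^ ν * realSum (besselDerivCoeff ν k) (x ^ 2) / x ^ k : ℝ) : ℂ) := by
  rw [iteratedDeriv_besselJ hν k (Complex.ofReal_mem_slitPlane.2 hx), ← Complex.ofReal_pow,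
    entireSum_ofReal]
  push_cast
  rw [Complex.ofReal_cpow (by positivity)]
  push_cast
  rfl

theorem realSum_linear_combination {u v w : ℕ → ℝ} (hu : EntireCoeff u) (hv : EntireCoeff v)
    (hw : EntireCoeff w) (p q r x : ℝ) :
    p * realSum u x + q * realSum v x + r * realSum w x =
      realSum (fun n => p * u n + q * v n + r * w n) x := by
  rw [((hu.const_mul p).add (hv.const_mul q)).realSum_add (hw.const_mul r),
    (hu.const_mul p).realSum_add (hv.const_mul q), realSum_const_mul, realSum_const_mul,
    realSum_const_mul]

/-! ### The normalized series of `N_ν` -/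

section NormalizedSeries

variable {a b c ν : ℝ}

/-- The coefficients of `N_ν(z) / z ^ ν`, normalized at `0`, as a power series in `z ^ 2`. -/
def normCoeff (a b c ν : ℝ) (n : ℕ) : ℝ :=
  Real.Gamma (ν + 1) / besselQ a b c ν * (besselQ a b c (ν + 2 * n) * besselCoeff ν n)

theorem normCoeff_posRooted (habc : (c = 0 ∧ a ≠ b) ∨ (0 < c ∧ a < b)) (hν : 0 ≤ ν)
    (hQ : ∀ x, ν ≤ x → besselQ a b c x ≠ 0) : JensenPosRooted (normCoeff a b c ν) where
  entire := by
    have h2 := entireCoeff_besselDerivCoeff hν 2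
    have h1 := entireCoeff_besselDerivCoeff hν 1
    have h0 := entireCoeff_besselDerivCoeff hν 0
    convert (((h2.const_mul a).add (h1.const_mul b)).add (h0.const_mul c)).const_mul
      (Real.Gamma (ν + 1) / besselQ a b c ν) using 1
    ext n
    simp only [normCoeff, besselDerivCoeff, Finset.prod_range_succ, Finset.prod_range_zero, besselQ]
    push_cast
    ring
  zero := by
    have h1 := hQ ν le_rfl
    have h2 : Real.Gamma (ν + 1) ≠ 0 := (Real.Gamma_pos_of_pos (by linarith)).ne'
    simp [normCoeff, besselCoeff, laguerreCoeff]
    field_simp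
  posRooted := by
    intro m
    have h1 := hQ ν le_rfl
    have h2 : Real.Gamma (ν + 1) ≠ 0 := (Real.Gamma_pos_of_pos (by linarith)).ne'
    have hk : ((Real.Gamma (ν + 1) / besselQ a b c ν : ℝ) : ℂ) ≠ 0 := by
      exact_mod_cast div_ne_zero h2 h1
    -- The `n!` of the Jensen polynomial cancels that in `besselCoeff`; the remaining `4^n` is a
    -- rescaling of the variable.
    convert ((posRooted_jensenPoly_besselQ habc hν hQ m).comp_C_mul_X
      (t := (1 / 4 : ℝ)) (by norm_num)).C_mul hk using 1
    ext n
    rw [Polynomial.coeff_C_mul, Polynomial.comp_C_mul_X_coeff, coeff_jensenPoly, coeff_jensenPoly,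
      normCoeff, besselCoeff, ← Complex.ofReal_pow, ← Complex.ofReal_mul, ← Complex.ofReal_mul]
    congr 1
    have : (n.factorial : ℝ) ≠ 0 := by positivity
    rw [one_div, inv_pow]
    field_simp

/-- A continuous function without zeros on `[ν, ∞)` keeps its sign there. -/
theorem besselQ_div_pos (hQ : ∀ x, ν ≤ x → besselQ a b c x ≠ 0) {y : ℝ} (hy : ν ≤ y) :
    0 < besselQ a b c y / besselQ a b c ν := by
  have hcont : Continuous fun x => besselQ a b c x / besselQ a b c ν := by
    unfold besselQ
    fun_prop
  by_contra! h
  obtain ⟨x, hx, hx0⟩ := intermediate_value_Icc' hy hcont.continuousOn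
    ⟨h, by simp [div_self (hQ ν le_rfl)]⟩
  exact div_ne_zero (hQ x hx.1) (hQ ν le_rfl) hx0

theorem normCoeff_one_neg (hν : 0 ≤ ν) (hQ : ∀ x, ν ≤ x → besselQ a b c x ≠ 0) :
    normCoeff a b c ν 1 < 0 := by
  have h1 := besselQ_div_pos hQ (by linarith : ν ≤ ν + 2)
  have h2 : 0 < Real.Gamma (ν + 1) := Real.Gamma_pos_of_pos (by linarith)
  have h3 : 0 < Real.Gamma (1 + ν + 1) := Real.Gamma_pos_of_pos (by linarith)
  have : normCoeff a b c ν 1 = -(besselQ a b c (ν + 2) / besselQ a b c ν *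
      (Real.Gamma (ν + 1) / (4 * Real.Gamma (1 + ν + 1)))) := by
    simp [normCoeff, besselCoeff, laguerreCoeff]
    ring
  rw [this]
  have : 0 < besselQ a b c (ν + 2) / besselQ a b c ν *
      (Real.Gamma (ν + 1) / (4 * Real.Gamma (1 + ν + 1))) := by positivity
  linarith

/-- Because `b - a ≠ 0`, `Q` is a nonzero polynomial with finitely many roots. If it has any, a
largest one exists and the bound on `ν` applies to it. -/
theorem besselQ_ne_zero_of_le (habc : (c = 0 ∧ a ≠ b) ∨ (0 < c ∧ a < b))
    (hν₀ : ∀ ν₀ : ℝ, IsGreatest {x : ℝ | besselQ a b c x = 0} ν₀ → ν₀ ≤ ν)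
    (hQ : besselQ a b c ν ≠ 0) {x : ℝ} (hx : ν ≤ x) : besselQ a b c x ≠ 0 := by
  intro h0
  have hne : a ≠ b := habc.elim (fun h => h.2) fun h => h.2.ne
  have hfin : {x : ℝ | besselQ a b c x = 0}.Finite := by
    set P : Polynomial ℝ := Polynomial.C a * Polynomial.X ^ 2 + Polynomial.C (b - a) * Polynomial.X
      + Polynomial.C c with hP
    have hP0 : P ≠ 0 := by
      intro h
      have := congrArg (fun P => Polynomial.coeff P 1) h
      simp [hP, Polynomial.coeff_X_pow, Polynomial.coeff_C] at this
      exact hne (by linarith)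
    refine (Polynomial.finite_setOfPred_isRoot hP0).subset fun x hx => ?_
    simp only [Set.mem_ofPred_eq, Polynomial.IsRoot.def, hP] at hx ⊢
    rw [besselQ] at hx
    simp
    linarith
  obtain ⟨y, hy, hmax⟩ := hfin.exists_maximal ⟨x, h0⟩
  have hgreat : IsGreatest {x : ℝ | besselQ a b c x = 0} y :=
    ⟨hy, fun z hz => (le_total z y).elim id fun h => hmax hz h⟩
  have h1 : x = ν := le_antisymm ((hgreat.2 h0).trans (hν₀ y hgreat)) hx
  exact hQ (h1 ▸ h0)

theorem realSum_normCoeff (hν : 0 ≤ ν) (hQ : besselQ a b c ν ≠ 0) (y : ℝ) :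
    a * realSum (besselDerivCoeff ν 2) y + b * realSum (besselDerivCoeff ν 1) y
        + c * realSum (besselDerivCoeff ν 0) y =
      besselQ a b c ν / Real.Gamma (ν + 1) * realSum (normCoeff a b c ν) y := by
  have h2 : Real.Gamma (ν + 1) ≠ 0 := (Real.Gamma_pos_of_pos (by linarith)).ne'
  rw [realSum_linear_combination (entireCoeff_besselDerivCoeff hν 2)
    (entireCoeff_besselDerivCoeff hν 1) (entireCoeff_besselDerivCoeff hν 0), ← realSum_const_mul]
  congr 1
  ext n
  simp only [normCoeff, besselDerivCoeff, Finset.prod_range_succ, Finset.prod_range_zero]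
  field_simp
  simp only [besselQ]
  push_cast
  ring

/-- The left side comes from `z N_ν'(z)`. On coefficients, with `s = ν + 2n`, it is the identity `a
s(s-1)(s-2) + (2a+b) s(s-1) + (b+c) s = s Q(s)`. -/
theorem realSum_normCoeff_deriv (hν : 0 ≤ ν) (hQ : besselQ a b c ν ≠ 0)
    (h : EntireCoeff (normCoeff a b c ν)) (y : ℝ) :
    a * realSum (besselDerivCoeff ν 3) y + (2 * a + b) * realSum (besselDerivCoeff ν 2) y
        + (b + c) * realSum (besselDerivCoeff ν 1) y =
      besselQ a b c ν / Real.Gamma (ν + 1) * (ν * realSum (normCoeff a b c ν) y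
        + 2 * realSum (fun n => n * normCoeff a b c ν n) y) := by
  have h2 : Real.Gamma (ν + 1) ≠ 0 := (Real.Gamma_pos_of_pos (by linarith)).ne'
  rw [realSum_linear_combination (entireCoeff_besselDerivCoeff hν 3)
    (entireCoeff_besselDerivCoeff hν 2) (entireCoeff_besselDerivCoeff hν 1),
    ← realSum_const_mul ν, ← realSum_const_mul 2,
    ← (h.const_mul ν).realSum_add (h.nat_mul.const_mul 2), ← realSum_const_mul]
  congr 1
  ext n
  simp only [normCoeff, besselDerivCoeff, Finset.prod_range_succ, Finset.prod_range_zero]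
  field_simp
  simp only [besselQ]
  push_cast
  ring

end NormalizedSeries

/-! ### Values on the positive real axis -/

section RealValues

variable {a b c ν x : ℝ}

theorem pow_mul_iteratedDeriv_besselJ (hν : 0 ≤ ν) (hx : 0 < x) (k : ℕ) :
    (x : ℂ) ^ k * iteratedDeriv k (besselJ ν) x =
      (((x / 2) ^ ν * realSum (besselDerivCoeff ν k) (x ^ 2) : ℝ) : ℂ) := by
  rw [iteratedDeriv_besselJ_ofReal hν k hx, ← Complex.ofReal_pow, ← Complex.ofReal_mul,
    mul_div_cancel₀ _ (by positivity)]

theorem besselN_ofReal (hν : 0 ≤ ν) (hQ : besselQ a b c ν ≠ 0) (hx : 0 < x) :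
    (a : ℂ) * x ^ 2 * iteratedDeriv 2 (besselJ ν) x + b * x * iteratedDeriv 1 (besselJ ν) x
        + c * besselJ ν x =
      (((x / 2) ^ ν * (besselQ a b c ν / Real.Gamma (ν + 1) *
        realSum (normCoeff a b c ν) (x ^ 2)) : ℝ) : ℂ) := by
  have h2 := pow_mul_iteratedDeriv_besselJ hν hx 2
  have h1 := pow_mul_iteratedDeriv_besselJ hν hx 1
  have h0 := pow_mul_iteratedDeriv_besselJ hν hx 0
  rw [iteratedDeriv_zero] at h0
  rw [← realSum_normCoeff hν hQ]
  push_cast at h0 h1 h2 ⊢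
  linear_combination (a : ℂ) * h2 + b * h1 + c * h0

theorem mul_deriv_besselN_ofReal (hν : 0 ≤ ν) (hQ : besselQ a b c ν ≠ 0)
    (h : EntireCoeff (normCoeff a b c ν)) (hx : 0 < x) :
    (a : ℂ) * x ^ 3 * iteratedDeriv 3 (besselJ ν) x
        + (2 * a + b) * x ^ 2 * iteratedDeriv 2 (besselJ ν) x
        + (b + c) * x * iteratedDeriv 1 (besselJ ν) x =
      (((x / 2) ^ ν * (besselQ a b c ν / Real.Gamma (ν + 1) *
        (ν * realSum (normCoeff a b c ν) (x ^ 2)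
          + 2 * realSum (fun n => n * normCoeff a b c ν n) (x ^ 2))) : ℝ) : ℂ) := by
  have h3 := pow_mul_iteratedDeriv_besselJ hν hx 3
  have h2 := pow_mul_iteratedDeriv_besselJ hν hx 2
  have h1 := pow_mul_iteratedDeriv_besselJ hν hx 1
  rw [← realSum_normCoeff_deriv hν hQ h]
  push_cast at h1 h2 h3 ⊢
  linear_combination (a : ℂ) * h3 + (2 * a + b) * h2 + (b + c) * h1

theorem two_rpow_mul_half_rpow (hx : 0 < x) : (2 : ℝ) ^ ν * (x / 2) ^ ν = x ^ ν := by
  rw [← Real.mul_rpow two_pos.le (by positivity), mul_div_cancel₀ _ two_ne_zero]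

theorem normF_ofReal (hν : 0 ≤ ν) (hν0 : ν ≠ 0) (hQ : besselQ a b c ν ≠ 0) (hx : 0 < x)
    (hφ : 0 < realSum (normCoeff a b c ν) (x ^ 2)) :
    normF a b c ν x = ((x * realSum (normCoeff a b c ν) (x ^ 2) ^ (1 / ν) : ℝ) : ℂ) := by
  have hG : Real.Gamma (ν + 1) ≠ 0 := (Real.Gamma_pos_of_pos (by linarith)).ne'
  have h2 : (2 : ℂ) ^ (ν : ℂ) = ((2 ^ ν : ℝ) : ℂ) := by
    rw [Complex.ofReal_cpow two_pos.le]; norm_num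
  have h1 : x * realSum (normCoeff a b c ν) (x ^ 2) ^ (1 / ν) =
      (2 ^ ν * Real.Gamma (ν + 1) / besselQ a b c ν * ((x / 2) ^ ν * (besselQ a b c ν /
        Real.Gamma (ν + 1) * realSum (normCoeff a b c ν) (x ^ 2)))) ^ (1 / ν) := by
    have h3 : 2 ^ ν * Real.Gamma (ν + 1) / besselQ a b c ν * ((x / 2) ^ ν * (besselQ a b c ν /
        Real.Gamma (ν + 1) * realSum (normCoeff a b c ν) (x ^ 2))) =
        x ^ ν * realSum (normCoeff a b c ν) (x ^ 2) := by
      rw [← two_rpow_mul_half_rpow hx]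
      field_simp
    rw [h3, Real.mul_rpow (by positivity) hφ.le, ← Real.rpow_mul hx.le, mul_one_div_cancel hν0,
      Real.rpow_one]
  -- A nonnegative base makes the principal complex power agree with the real one.
  have hnn : 0 ≤ 2 ^ ν * Real.Gamma (ν + 1) / besselQ a b c ν * ((x / 2) ^ ν * (besselQ a b c ν /
        Real.Gamma (ν + 1) * realSum (normCoeff a b c ν) (x ^ 2))) := by
    have h3 : 2 ^ ν * Real.Gamma (ν + 1) / besselQ a b c ν * ((x / 2) ^ ν * (besselQ a b c ν /
        Real.Gamma (ν + 1) * realSum (normCoeff a b c ν) (x ^ 2))) =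
        2 ^ ν * (x / 2) ^ ν * realSum (normCoeff a b c ν) (x ^ 2) := by
      field_simp
    rw [h3]
    positivity
  rw [normF, besselN, besselN_ofReal hν hQ hx, h2, h1, Complex.ofReal_cpow hnn]
  push_cast
  rfl

theorem normG_ofReal (hν : 0 ≤ ν) (hQ : besselQ a b c ν ≠ 0) (hx : 0 < x) :
    normG a b c ν x = ((x * realSum (normCoeff a b c ν) (x ^ 2) ^ (1 : ℝ) : ℝ) : ℂ) := by
  have hG : Real.Gamma (ν + 1) ≠ 0 := (Real.Gamma_pos_of_pos (by linarith)).ne'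
  have h2 : (2 : ℂ) ^ (ν : ℂ) = ((2 ^ ν : ℝ) : ℂ) := by
    rw [Complex.ofReal_cpow two_pos.le]; norm_num
  have h3 : (x : ℂ) ^ (1 - (ν : ℂ)) = ((x ^ (1 - ν) : ℝ) : ℂ) := by
    rw [Complex.ofReal_cpow hx.le]; norm_num
  rw [normG, besselN, besselN_ofReal hν hQ hx, h2, h3, Real.rpow_one]
  norm_cast
  have h4 : x = x ^ ν * x ^ (1 - ν) := by rw [← Real.rpow_add hx]; simp
  have h5 : x * realSum (normCoeff a b c ν) (x ^ 2) =
      2 ^ ν * (x / 2) ^ ν * x ^ (1 - ν) * realSum (normCoeff a b c ν) (x ^ 2) := by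
    rw [two_rpow_mul_half_rpow hx, ← h4]
  rw [h5]
  field_simp

theorem normH_ofReal (hν : 0 ≤ ν) (hQ : besselQ a b c ν ≠ 0) (hx : 0 < x) :
    normH a b c ν x = ((x * realSum (normCoeff a b c ν) (x ^ 1) ^ (1 : ℝ) : ℝ) : ℂ) := by
  have hG : Real.Gamma (ν + 1) ≠ 0 := (Real.Gamma_pos_of_pos (by linarith)).ne'
  have h2 : (2 : ℂ) ^ (ν : ℂ) = ((2 ^ ν : ℝ) : ℂ) := by
    rw [Complex.ofReal_cpow two_pos.le]; norm_num
  have h3 : (x : ℂ) ^ (1 - (ν : ℂ) / 2) = ((x ^ (1 - ν / 2) : ℝ) : ℂ) := by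
    rw [Complex.ofReal_cpow hx.le]; norm_num
  have h5 : (x : ℂ) ^ (1 / 2 : ℂ) = ((√x : ℝ) : ℂ) := by
    rw [Real.sqrt_eq_rpow, Complex.ofReal_cpow hx.le]; norm_num
  have hs : 0 < √x := Real.sqrt_pos.2 hx
  rw [normH, h5, besselN, besselN_ofReal hν hQ hs, h2, h3, Real.sq_sqrt hx.le, pow_one,
    Real.rpow_one]
  norm_cast
  have h4 : x = √x ^ ν * x ^ (1 - ν / 2) := by
    rw [Real.sqrt_eq_rpow, ← Real.rpow_mul hx.le, ← Real.rpow_add hx]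
    ring_nf
    simp
  have h6 : x * realSum (normCoeff a b c ν) x =
      2 ^ ν * (√x / 2) ^ ν * x ^ (1 - ν / 2) * realSum (normCoeff a b c ν) x := by
    rw [two_rpow_mul_half_rpow hs, ← h4]
  rw [h6]
  field_simp

end RealValues

end

/-! ### The three radii -/

theorem theorem2 (a b c ν β : ℝ)
    (habc : (c = 0 ∧ a ≠ b) ∨ (0 < c ∧ a < b))
    (hβ : 0 ≤ β ∧ β < 1)
    (hν : 0 ≤ ν)
    (hν₀ : ∀ ν₀ : ℝ, IsGreatest {x : ℝ | besselQ a b c x = 0} ν₀ → ν₀ ≤ ν)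
    (hQ : besselQ a b c ν ≠ 0) :
    (ν ≠ 0 → ∃ ρ : ℝ, IsRadiusOfStarlikeness β (normF a b c ν) ρ ∧
      IsLeast {r : ℝ | 0 < r ∧
        (a : ℂ) * r ^ 3 * iteratedDeriv 3 (besselJ ν) r
          + (2 * a + b - a * ν * β) * r ^ 2 * iteratedDeriv 2 (besselJ ν) r
          + (b + c - b * ν * β) * r * iteratedDeriv 1 (besselJ ν) r
          - c * ν * β * besselJ ν r = 0} ρ) ∧
    (∃ ρ : ℝ, IsRadiusOfStarlikeness β (normG a b c ν) ρ ∧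
      IsLeast {r : ℝ | 0 < r ∧
        (a : ℂ) * r ^ 2 * iteratedDeriv 2 (besselJ ν) r
          + b * r * iteratedDeriv 1 (besselJ ν) r + c * besselJ ν r ≠ 0 ∧
        (1 - (ν : ℂ)) +
          (a * r ^ 3 * iteratedDeriv 3 (besselJ ν) r
            + (2 * a + b) * r ^ 2 * iteratedDeriv 2 (besselJ ν) r
            + (b + c) * r * iteratedDeriv 1 (besselJ ν) r) /
          (a * r ^ 2 * iteratedDeriv 2 (besselJ ν) r
            + b * r * iteratedDeriv 1 (besselJ ν) r + c * besselJ ν r) = β} ρ) ∧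
    (∃ ρ : ℝ, IsRadiusOfStarlikeness β (normH a b c ν) ρ ∧
      IsLeast {r : ℝ | 0 < r ∧
        (a : ℂ) * r * iteratedDeriv 2 (besselJ ν) (√r : ℝ)
          + b * (√r : ℝ) * iteratedDeriv 1 (besselJ ν) (√r : ℝ) + c * besselJ ν (√r : ℝ) ≠ 0 ∧
        (2 - (ν : ℂ)) +
          (a * r * (√r : ℝ) * iteratedDeriv 3 (besselJ ν) (√r : ℝ)
            + (2 * a + b) * r * iteratedDeriv 2 (besselJ ν) (√r : ℝ)
            + (b + c) * (√r : ℝ) * iteratedDeriv 1 (besselJ ν) (√r : ℝ)) /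
          (a * r * iteratedDeriv 2 (besselJ ν) (√r : ℝ)
            + b * (√r : ℝ) * iteratedDeriv 1 (besselJ ν) (√r : ℝ)
            + c * besselJ ν (√r : ℝ)) = 2 * β} ρ) := by
  have hQ' : ∀ x, ν ≤ x → besselQ a b c x ≠ 0 := fun x hx => besselQ_ne_zero_of_le habc hν₀ hQ hx
  have h := normCoeff_posRooted habc hν hQ'
  have h1 := normCoeff_one_neg hν hQ'
  have hK : besselQ a b c ν / Real.Gamma (ν + 1) ≠ 0 :=
    div_ne_zero hQ (Real.Gamma_pos_of_pos (by linarith)).ne'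
  have hT : ∀ x : ℝ, 0 < x → (x / 2) ^ ν ≠ 0 := fun x hx => (Real.rpow_pos_of_pos (by positivity) _).ne'
  refine ⟨fun hν0 => ?_, ?_, ?_⟩
  · have hνpos : 0 < ν := lt_of_le_of_ne hν hν0.symm
    obtain ⟨ρ, hρ, -, hD, hmin, hrad⟩ :=
      h.exists_radius h1 (κ := 1 / ν) (by positivity) hβ.2 two_ne_zero
    -- The left side is `z N_ν' - νβ N_ν` at `r`, a nonzero multiple of the critical function at `r
    -- ^ 2`.
    have key : ∀ r : ℝ, 0 < r → ((a : ℂ) * r ^ 3 * iteratedDeriv 3 (besselJ ν) r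
          + (2 * a + b - a * ν * β) * r ^ 2 * iteratedDeriv 2 (besselJ ν) r
          + (b + c - b * ν * β) * r * iteratedDeriv 1 (besselJ ν) r
          - c * ν * β * besselJ ν r = 0 ↔
        (1 - β) * realSum (normCoeff a b c ν) (r ^ 2)
          + 1 / ν * (2 : ℕ) * realSum (fun n => n * normCoeff a b c ν n) (r ^ 2) = 0) := by
      intro r hr
      have e1 := besselN_ofReal hν hQ hr
      have e2 := mul_deriv_besselN_ofReal hν hQ h.entire hr
      have e3 : (a : ℂ) * r ^ 3 * iteratedDeriv 3 (besselJ ν) r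
          + (2 * a + b - a * ν * β) * r ^ 2 * iteratedDeriv 2 (besselJ ν) r
          + (b + c - b * ν * β) * r * iteratedDeriv 1 (besselJ ν) r
          - c * ν * β * besselJ ν r =
          (((r / 2) ^ ν * (besselQ a b c ν / Real.Gamma (ν + 1)) * ν *
            ((1 - β) * realSum (normCoeff a b c ν) (r ^ 2)
          + 1 / ν * (2 : ℕ) * realSum (fun n => n * normCoeff a b c ν n) (r ^ 2)) : ℝ) : ℂ) := by
        have hν' : (ν : ℂ) ≠ 0 := by exact_mod_cast hν0
        have e4 : (((r / 2) ^ ν * (besselQ a b c ν / Real.Gamma (ν + 1)) * ν *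
            ((1 - β) * realSum (normCoeff a b c ν) (r ^ 2)
          + 1 / ν * (2 : ℕ) * realSum (fun n => n * normCoeff a b c ν n) (r ^ 2)) : ℝ)) =
          (r / 2) ^ ν * (besselQ a b c ν / Real.Gamma (ν + 1) *
            (ν * realSum (normCoeff a b c ν) (r ^ 2)
              + 2 * realSum (fun n => n * normCoeff a b c ν n) (r ^ 2)))
          - ν * β * ((r / 2) ^ ν * (besselQ a b c ν / Real.Gamma (ν + 1) *
            realSum (normCoeff a b c ν) (r ^ 2))) := by
          push_cast
          field_simp
          ring
        rw [e4, Complex.ofReal_sub, ← e2, Complex.ofReal_mul (ν * β), ← e1]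
        push_cast
        ring
      rw [e3, Complex.ofReal_eq_zero, mul_eq_zero, mul_eq_zero, mul_eq_zero]
      simp [hT r hr, hK, hν0]
    refine ⟨ρ, hrad _ fun x hx hφ => normF_ofReal hν hν0 hQ hx hφ, ⟨hρ, (key ρ hρ).2 hD⟩, ?_⟩
    rintro r ⟨hr, h0⟩
    exact hmin r hr ((key r hr).1 h0)
  · obtain ⟨ρ, hρ, hφρ, hD, hmin, hrad⟩ :=
      h.exists_radius h1 (κ := 1) one_pos hβ.2 two_ne_zero
    -- The nonvanishing clause rules out spurious solutions from division by zero. At `ρ` it holds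
    -- because `φ` is still positive there; minimality needs only the cleared equation.
    have key : ∀ r : ℝ, 0 < r → ((a : ℂ) * r ^ 2 * iteratedDeriv 2 (besselJ ν) r
          + b * r * iteratedDeriv 1 (besselJ ν) r + c * besselJ ν r ≠ 0 ∧
        (1 - (ν : ℂ)) +
          (a * r ^ 3 * iteratedDeriv 3 (besselJ ν) r
            + (2 * a + b) * r ^ 2 * iteratedDeriv 2 (besselJ ν) r
            + (b + c) * r * iteratedDeriv 1 (besselJ ν) r) /
          (a * r ^ 2 * iteratedDeriv 2 (besselJ ν) r
            + b * r * iteratedDeriv 1 (besselJ ν) r + c * besselJ ν r) = β ↔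
        realSum (normCoeff a b c ν) (r ^ 2) ≠ 0 ∧
        (1 - β) * realSum (normCoeff a b c ν) (r ^ 2)
          + 1 * (2 : ℕ) * realSum (fun n => n * normCoeff a b c ν n) (r ^ 2) = 0) := by
      intro r hr
      have hTr := hT r hr
      rw [besselN_ofReal hν hQ hr, mul_deriv_besselN_ofReal hν hQ h.entire hr]
      norm_cast
      rw [mul_eq_zero, mul_eq_zero, or_iff_right hTr, or_iff_right hK]
      refine and_congr_right fun hφ => ?_
      rw [mul_div_mul_left _ _ hTr, mul_div_mul_left _ _ hK]
      field_simp
      push_cast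
      constructor <;> intro h <;> linarith
    refine ⟨ρ, hrad _ fun x hx _ => normG_ofReal hν hQ hx,
      ⟨hρ, (key ρ hρ).2 ⟨hφρ.ne', hD⟩⟩, ?_⟩
    rintro r ⟨hr, h0⟩
    exact hmin r hr ((key r hr).1 h0).2
  · obtain ⟨ρ, hρ, hφρ, hD, hmin, hrad⟩ :=
      h.exists_radius h1 (κ := 1) one_pos hβ.2 one_ne_zero
    have key : ∀ r : ℝ, 0 < r → ((a : ℂ) * r * iteratedDeriv 2 (besselJ ν) (√r : ℝ)
          + b * (√r : ℝ) * iteratedDeriv 1 (besselJ ν) (√r : ℝ) + c * besselJ ν (√r : ℝ) ≠ 0 ∧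
        (2 - (ν : ℂ)) +
          (a * r * (√r : ℝ) * iteratedDeriv 3 (besselJ ν) (√r : ℝ)
            + (2 * a + b) * r * iteratedDeriv 2 (besselJ ν) (√r : ℝ)
            + (b + c) * (√r : ℝ) * iteratedDeriv 1 (besselJ ν) (√r : ℝ)) /
          (a * r * iteratedDeriv 2 (besselJ ν) (√r : ℝ)
            + b * (√r : ℝ) * iteratedDeriv 1 (besselJ ν) (√r : ℝ)
            + c * besselJ ν (√r : ℝ)) = 2 * β ↔
        realSum (normCoeff a b c ν) (r ^ 1) ≠ 0 ∧
        (1 - β) * realSum (normCoeff a b c ν) (r ^ 1)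
          + 1 * (1 : ℕ) * realSum (fun n => n * normCoeff a b c ν n) (r ^ 1) = 0) := by
      intro r hr
      have hs : 0 < √r := Real.sqrt_pos.2 hr
      have hTr := hT _ hs
      -- Substituting `√r` for the variable reduces to the formulas for `N_ν`, with `φ` now
      -- evaluated at `r` itself, hence `p = 1`.
      have hr2 : (r : ℂ) = ((√r : ℝ) : ℂ) ^ 2 := by
        rw [← Complex.ofReal_pow, Real.sq_sqrt hr.le]
      have hr3 : (a : ℂ) * r * (√r : ℝ) = a * ((√r : ℝ) : ℂ) ^ 3 := by rw [hr2]; ring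
      rw [hr3, hr2, besselN_ofReal hν hQ hs, mul_deriv_besselN_ofReal hν hQ h.entire hs,
        Real.sq_sqrt hr.le, pow_one]
      norm_cast
      rw [mul_eq_zero, mul_eq_zero, or_iff_right hTr, or_iff_right hK]
      refine and_congr_right fun hφ => ?_
      rw [mul_div_mul_left _ _ hTr, mul_div_mul_left _ _ hK]
      field_simp
      push_cast
      constructor <;> intro h <;> linarith
    refine ⟨ρ, hrad _ fun x hx _ => normH_ofReal hν hQ hx,
      ⟨hρ, (key ρ hρ).2 ⟨hφρ.ne', hD⟩⟩, ?_⟩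
    rintro r ⟨hr, h0⟩
    exact hmin r hr ((key r hr).1 h0).2
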